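/- Fix a finite relational signature (finitely many relation symbols, each of some arity in $\mathbb N$). For a relational structure $\mathcal R$ with domain $V$ and $A\subseteq V$, let $\mathcal R_{\restriction A}$ be the substructure induced on $A$. The age of $\mathcal R$ is the class of all finite structures that embed in $\mathcal R$ (i.e. are isomorphic to $\mathcal R_{\restriction A}$ for some finite $A\subseteq V$). A monomorphic decomposition of $\mathcal R$ is a partition $\mathcal P$ of $V$ into nonempty blocks such that, for all finite $A,A'\subseteq V$, if $|A\cap B|=|A'\cap B|$ for every $B\in\mathcal P$, then $\mathcal R_{\restriction A}\cong\mathcal R_{\restriction A'}$; it is finite if it has finitely many blocks. Theorem. Let $\mathfrak C$ be a hereditary class of finite relational structures of this signature, that is, every structure which embeds in a member of $\mathfrak C$ belongs to $\mathfrak C$. Then exactly one of the following holds: 1. $\mathfrak C$ is a union of finitely many (possibly zero) ages of relational structures, each of which admits a finite monomorphic decomposition; 2. $\mathfrak C$ contains the age $\mathfrak D$ of a structure $\mathcal R$ that does not have a finite monomorphic decomposition, and $\mathfrak D$ is minimal with respect to inclusion among all ages of structures that do not have a finite monomorphic decomposition. -/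

import Mathlib

universe u v w

namespace Monomorphic

open FirstOrder CategoryTheory

variable {L : FirstOrder.Language.{u, v}} [L.IsRelational]

/-- The restriction `R ↾ A` of a relational structure `R` to a subset `A` of its domain: the
substructure induced on `A` (every subset carries one since there are no function symbols). -/
def restriction (L : FirstOrder.Language.{u, v}) [L.IsRelational] {V : Type w} [L.Structure V] (A : Set V) :
    L.Substructure V where
  carrier := A
  fun_mem := fun f => isEmptyElim f

/-- A set `P` of subsets of the domain `V` is a monomorphic decomposition if it is a partition of
`V` (into nonempty blocks) such that the restrictions to two finite subsets `A`, `A'` of `V` are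
isomorphic as soon as `|A ∩ B| = |A' ∩ B|` for every block `B`. -/
def IsMonomorphicDecomposition (L : FirstOrder.Language.{u, v}) [L.IsRelational] {V : Type w} [L.Structure V]
    (P : Set (Set V)) : Prop :=
  Setoid.IsPartition P ∧
    ∀ A A' : Finset V,
      (∀ B ∈ P, ((A : Set V) ∩ B).ncard = ((A' : Set V) ∩ B).ncard) →
        Nonempty (restriction L (A : Set V) ≃[L] restriction L (A' : Set V))

/-- The structure with domain `V` admits a monomorphic decomposition with finitely many blocks. -/
def HasFiniteMonomorphicDecomposition (L : FirstOrder.Language.{u, v}) [L.IsRelational] (V : Type w)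
    [L.Structure V] : Prop :=
  ∃ P : Set (Set V), P.Finite ∧ IsMonomorphicDecomposition L P

/-- `C` is a finite union of ages of structures, each admitting a finite monomorphic
decomposition. -/
def IsFiniteUnionOfFMDAges (C : Set (Bundled.{w} L.Structure)) : Prop :=
  ∃ S : Set (Bundled.{w} L.Structure), S.Finite ∧
    (∀ R ∈ S, HasFiniteMonomorphicDecomposition L R) ∧ C = ⋃ R ∈ S, L.age R

/-- `D` is the age of some structure having no finite monomorphic decomposition. -/
def IsNonFMDAge (D : Set (Bundled.{w} L.Structure)) : Prop :=
  ∃ R : Bundled.{w} L.Structure, ¬ HasFiniteMonomorphicDecomposition L R ∧ D = L.age R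

end Monomorphic

/-!
A structure `V` is *chain decomposable* if its elements can be given finitely many colours, and each
colour a linear order, so that the relations on a tuple depend only on its pattern: the colours of
its entries and the order of the entries inside each colour (`ChainDecomposable`). The order is
recorded by natural numbers, since only finite structures are decomposed in this way. The proof
compares finite monomorphic decompositions with chain decompositions in a bounded number of colours:
a structure has a finite monomorphic decomposition if and only if the members of its age have chain
decompositions in `K` colours, for some fixed `K`. One direction
(`HasFiniteMonomorphicDecomposition.exists_chainDecomposable`) is Ramsey's theorem, applied to
sequences in the infinite blocks; the other (`hasFiniteMonomorphicDecomposition_of_age`) is a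
compactness argument. In particular a finite union of ages of structures with finite monomorphic
decompositions contains no other ages, and so the two alternatives exclude each other.

Two facts about chain decompositions carry the rest of the argument.

* For fixed `K`, the finite structures with chain decompositions in `K` colours are
  well-quasi-ordered by embeddability (`exists_embedding_of_chainDecomposable`): a finite table and
  the numbers of elements of each colour determine such a structure, and Dickson's lemma applies.
* If all one-point deletions of a finite structure have chain decompositions in `K` colours, then
  the structure has one in `K'` colours, where `K'` depends on `K` and the signature only
  (`exists_chainDecomposable_of_deletions`). If `m` bounds the arities, it suffices to find a
  colouring and an order that work for the deletions of `m + 1` points, since a tuple misses one of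
  these points. In a decomposition, the order of a colour is either irrelevant or definable, up to
  reversal, by an atomic formula with few parameters (`swapInvariant_or_oriented`). The points
  are chosen outside each other's parameters. After all colours have been cut at the parameters,
  the definable orders can be read off in each of the deletions, so that they agree.

Hence the minimal structures outside a finite union of ages of structures with finite monomorphic
decompositions are well-quasi-ordered. If all ages contained in a hereditary class `C` have finite
monomorphic decompositions, then a minimal bad sequence in `C` would consist of such minimal
structures; so `C` is well-quasi-ordered, and is a finite union of ages
(`isFiniteUnionOfFMDAges_of_forall_age`). Otherwise `C` contains the age of a structure without
finite monomorphic decomposition, and Zorn's lemma gives a minimal one. If the intersection of a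
chain of such ages contained no such age, it would be a finite union of ages as above, and minimal
structures outside the intersection, taken from smaller and smaller members of the chain, would form
a bad sequence (`exists_isNonFMDAge_lowerBound`).
-/

namespace Monomorphic

open FirstOrder FirstOrder.Language FirstOrder.Language.Structure CategoryTheory

/-! ### Chain decompositions -/

/-- Two tuples, in two coloured sets whose elements carry positions, have the same pattern if
corresponding entries have the same colour and, inside each colour, the entries are arranged in
the same order. Nothing is asked about entries of different colours. -/
def SamePattern {V W ι : Type*} {n : ℕ} (c : V → ι) (pos : V → ℕ) (c' : W → ι) (pos' : W → ℕ)
    (s : Fin n → V) (t : Fin n → W) : Prop :=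
  (∀ l, c (s l) = c' (t l)) ∧
    ∀ l l', c (s l) = c (s l') → (pos (s l) < pos (s l') ↔ pos' (t l) < pos' (t l'))

/-- The colouring `c` and the positions `pos` form a chain decomposition of the restriction to
`S`: the relations on tuples of `S` depend on their patterns only. -/
def ChainOn (L : FirstOrder.Language.{u, v}) {V : Type*} [L.Structure V] {ι : Type*} (S : Set V)
    (c : V → ι) (pos : V → ℕ) : Prop :=
  ∀ ⦃n : ℕ⦄ (r : L.Relations n) (s t : Fin n → V), (∀ l, s l ∈ S) → (∀ l, t l ∈ S) →
    SamePattern c pos c pos s t → (RelMap r s ↔ RelMap r t)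

/-- The structure `M` has a chain decomposition with colours in `ι`. Positions need to separate
elements of the same colour only. -/
def ChainDecomposable (L : FirstOrder.Language.{u, v}) (ι : Type*) (M : Type*)
    [L.Structure M] : Prop :=
  ∃ (c : M → ι) (pos : M → ℕ), Function.Injective (fun v => (c v, pos v)) ∧
    ChainOn L Set.univ c pos

section Basic

variable {L : FirstOrder.Language.{u, v}} {V W ι : Type*} {n : ℕ} {c : V → ι} {pos : V → ℕ}
  {c' : W → ι} {pos' : W → ℕ} {s : Fin n → V} {t : Fin n → W}

theorem SamePattern.eq_iff (h : SamePattern c pos c' pos' s t)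
    (hc : Function.Injective fun v => (c v, pos v))
    (hc' : Function.Injective fun v => (c' v, pos' v)) (l l' : Fin n) :
    s l = s l' ↔ t l = t l' := by
  constructor
  · intro e
    have e1 : c (s l) = c (s l') := by rw [e]
    have h1 := h.2 l l' e1
    have h2 := h.2 l' l e1.symm
    refine hc' (Prod.ext ?_ ?_)
    · simp only [← h.1, e]
    · rw [e] at h1 h2
      simp only [lt_self_iff_false, false_iff, not_lt] at h1 h2 ⊢
      omega
  · intro e
    have e1 : c (s l) = c (s l') := by rw [h.1, h.1, e]
    have h1 := h.2 l l' e1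
    have h2 := h.2 l' l e1.symm
    refine hc (Prod.ext e1 ?_)
    rw [e] at h1 h2
    simp only [lt_self_iff_false, iff_false, not_lt] at h1 h2 ⊢
    omega

theorem ChainDecomposable.map_colour [L.Structure V] {κ : Type*} (h : ChainDecomposable L ι V)
    (f : ι ↪ κ) : ChainDecomposable L κ V := by
  obtain ⟨c, pos, hi, hc⟩ := h
  refine ⟨f ∘ c, pos, fun a b e => hi ?_, fun n r s t hs ht hst => hc r s t hs ht ?_⟩
  · simpa using e
  · exact ⟨fun l => f.injective (hst.1 l), fun l l' e => hst.2 l l' (congrArg f e)⟩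

theorem ChainDecomposable.mono_fin [L.Structure V] {k k' : ℕ}
    (h : ChainDecomposable L (Fin k) V) (hk : k ≤ k') : ChainDecomposable L (Fin k') V :=
  h.map_colour (Fin.castLEEmb hk)

theorem ChainDecomposable.fin_card [L.Structure V] [Finite ι]
    (h : ChainDecomposable L ι V) : ChainDecomposable L (Fin (Nat.card ι)) V :=
  h.map_colour (Finite.equivFin ι).toEmbedding

/-- A finite set with positions embeds, respecting positions, in every such set that is at least
as large. -/
theorem exists_position_embedding {X Y : Type*} [Finite X] [Finite Y] (p : X → ℕ) (q : Y → ℕ)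
    (hp : Function.Injective p) (hq : Function.Injective q) (h : Nat.card X ≤ Nat.card Y) :
    ∃ g : X → Y, ∀ a b, p a < p b ↔ q (g a) < q (g b) := by
  classical
  let := Fintype.ofFinite X
  let := Fintype.ofFinite Y
  let : LinearOrder X := LinearOrder.lift' p hp
  let : LinearOrder Y := LinearOrder.lift' q hq
  rw [Nat.card_eq_fintype_card, Nat.card_eq_fintype_card] at h
  let eX := Fintype.orderIsoFinOfCardEq X rfl
  let eY := Fintype.orderIsoFinOfCardEq Y rfl
  let g : X → Y := fun x => eY (Fin.castLE h (eX.symm x))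
  refine ⟨g, fun a b => ?_⟩
  have h1 : p a < p b ↔ a < b := Iff.rfl
  have h2 : q (g a) < q (g b) ↔ g a < g b := Iff.rfl
  rw [h1, h2]
  simp [g]

/-- If the relations of `V` and `W` depend in the same way on patterns, and `W` has at least as
many elements of each colour as `V`, then `V` embeds in `W`. -/
theorem nonempty_embedding_of_samePattern [L.IsRelational] [L.Structure V] [L.Structure W]
    [Finite V] [Finite W]
    (hc : Function.Injective fun v => (c v, pos v))
    (hc' : Function.Injective fun v => (c' v, pos' v))
    (hrel : ∀ ⦃n : ℕ⦄ (r : L.Relations n) (s : Fin n → V) (t : Fin n → W),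
      SamePattern c pos c' pos' s t → (RelMap r s ↔ RelMap r t))
    (hcard : ∀ k, Nat.card {v // c v = k} ≤ Nat.card {v // c' v = k}) :
    Nonempty (V ↪[L] W) := by
  have key : ∀ k, ∃ g : {v // c v = k} → {v // c' v = k}, ∀ a b : {v // c v = k},
      pos a < pos b ↔ pos' (g a) < pos' (g b) := by
    intro k
    refine exists_position_embedding (fun v : {v // c v = k} => pos v)
      (fun v : {v // c' v = k} => pos' v) ?_ ?_ (hcard k)
    · rintro ⟨a, ha⟩ ⟨b, hb⟩ e
      exact Subtype.ext (hc (Prod.ext (ha.trans hb.symm) e))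
    · rintro ⟨a, ha⟩ ⟨b, hb⟩ e
      exact Subtype.ext (hc' (Prod.ext (ha.trans hb.symm) e))
  choose g hg using key
  let f : V → W := fun v => g (c v) ⟨v, rfl⟩
  have hf : ∀ v, c' (f v) = c v := fun v => (g (c v) ⟨v, rfl⟩).2
  have hpos : ∀ a b, c a = c b → (pos a < pos b ↔ pos' (f a) < pos' (f b)) := by
    intro a b e
    have h1 := hg (c b) ⟨a, e⟩ ⟨b, rfl⟩
    have h2 : ∀ k (e : c a = k), (g k ⟨a, e⟩ : W) = f a := by rintro _ rfl; rfl
    rw [h2] at h1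
    exact h1
  have hpat : ∀ {n : ℕ} (s : Fin n → V), SamePattern c pos c' pos' s (f ∘ s) :=
    fun s => ⟨fun l => (hf _).symm, fun l l' e => hpos _ _ e⟩
  have hinj : Function.Injective f := by
    intro a b e
    have := ((hpat ![a, b]).eq_iff hc hc' 0 1).2
    simpa using this (by simpa using e)
  exact ⟨{ toFun := f, inj' := hinj, map_fun' := fun φ => isEmptyElim φ,
           map_rel' := fun r s => (hrel r s _ (hpat s)).symm }⟩

end Basic

/-- Finite structures with a chain decomposition in a fixed finite number of colours are
well-quasi-ordered by embeddability: such a structure is determined by the finite table of the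
relations its patterns satisfy and by the number of its elements of each colour, so this is
Dickson's lemma. -/
theorem exists_embedding_of_chainDecomposable {L : FirstOrder.Language.{u, v}} [L.IsRelational]
    [Finite (Σ n, L.Relations n)] {ι : Type*} [Finite ι] (f : ℕ → Bundled.{w} L.Structure)
    (hfin : ∀ n, Finite (f n)) (h : ∀ n, ChainDecomposable L ι (f n)) :
    ∃ m n, m < n ∧ Nonempty (f m ↪[L] f n) := by
  choose c pos hi hc using h
  let T : ℕ → ∀ p : (Σ n, L.Relations n), (Fin p.1 → ι) → (Fin p.1 → Fin p.1 → Prop) → Prop :=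
    fun m p κ ρ => ∃ s : Fin p.1 → f m, (∀ l, c m (s l) = κ l) ∧
      (∀ l l', κ l = κ l' → (pos m (s l) < pos m (s l') ↔ ρ l l')) ∧ RelMap p.2 s
  have hT : ∀ m n (r : L.Relations n) (s : Fin n → f m),
      RelMap r s ↔ T m ⟨n, r⟩ (fun l => c m (s l)) (fun l l' => pos m (s l) < pos m (s l')) := by
    intro m n r s
    constructor
    · exact fun hr => ⟨s, fun _ => rfl, fun _ _ _ => Iff.rfl, hr⟩
    · rintro ⟨t, h1, h2, h3⟩
      refine (hc m r t s (by simp) (by simp) ⟨h1, fun l l' e => h2 l l' ?_⟩).1 h3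
      rw [← h1, ← h1, e]
  have hT' : ∀ m n (r : L.Relations n) (κ : Fin n → ι) (ρ ρ' : Fin n → Fin n → Prop),
      (∀ l l', κ l = κ l' → (ρ l l' ↔ ρ' l l')) → T m ⟨n, r⟩ κ ρ → T m ⟨n, r⟩ κ ρ' := by
    rintro m n r κ ρ ρ' hρ ⟨t, h1, h2, h3⟩
    exact ⟨t, h1, fun l l' e => (h2 l l' e).trans (hρ l l' e), h3⟩
  obtain ⟨m, n, hmn, h1, h2⟩ := (Finite.wellQuasiOrdered
    (α := ∀ p : (Σ n, L.Relations n), (Fin p.1 → ι) → (Fin p.1 → Fin p.1 → Prop) → Prop)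
    (· = ·)).prod (wellQuasiOrdered_le (α := ι → ℕ))
    (fun m => (T m, fun k => Nat.card {v : f m // c m v = k}))
  simp only at h1
  have := hfin m
  have := hfin n
  refine ⟨m, n, hmn, nonempty_embedding_of_samePattern (hi m) (hi n) ?_ h2⟩
  intro N r s t hst
  have e : (fun l => c m (s l)) = fun l => c n (t l) := funext hst.1
  rw [hT, hT, h1, e]
  exact ⟨hT' _ _ _ _ _ _ fun l l' e => hst.2 l l' (by rw [hst.1, hst.1]; exact e),
    hT' _ _ _ _ _ _ fun l l' e => (hst.2 l l' (by rw [hst.1, hst.1]; exact e)).symm⟩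

/-! ### Colours without order and oriented colours -/

section Orientation

variable {V ι : Type*}

open Classical in
/-- Inside `S`, exchanging two elements of colour `k` never affects a relation, so that the order
of the elements of colour `k` is irrelevant. -/
def SwapInvariant (L : FirstOrder.Language.{u, v}) [L.Structure V] (S : Set V) (c : V → ι)
    (k : ι) : Prop :=
  ∀ a ∈ S, ∀ b ∈ S, c a = k → c b = k → ∀ ⦃n : ℕ⦄ (r : L.Relations n) (s : Fin n → V),
    (∀ l, s l ∈ S) → (RelMap r s ↔ RelMap r (Equiv.swap a b ∘ s))

open Classical in
/-- The tuple obtained from `t` by putting `y` at the places in `I` and `z` at the other places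
in `J`. -/
noncomputable def plug {n : ℕ} (I J : Set (Fin n)) (t : Fin n → V) (y z : V) (l : Fin n) : V :=
  if l ∈ I then y else if l ∈ J then z else t l

/-- Outside `P`, the order of the elements of colour `k` is defined, up to reversal, by an atomic
formula with parameters in `S ∩ P`. -/
def Oriented (L : FirstOrder.Language.{u, v}) [L.Structure V] (S : Set V) (c : V → ι)
    (pos : V → ℕ) (k : ι) (P : Set V) : Prop :=
  ∃ (n : ℕ) (r : L.Relations n) (I J : Set (Fin n)) (t : Fin n → V) (φ : Prop),
    (∀ l, t l ∈ S ∧ t l ∈ P) ∧ ∀ y z, y ∈ S → z ∈ S → c y = k → c z = k → y ∉ P → z ∉ P →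
      y ≠ z → (RelMap r (plug I J t y z) ↔ (pos y < pos z ↔ φ))

/-- The increasing enumeration of a finite set by positions. -/
theorem exists_enumeration [Nonempty V] (X : Finset V) (pos : V → ℕ) (hpos : Set.InjOn pos X) :
    ∃ e : ℕ → V, (∀ i < X.card, e i ∈ X) ∧ (∀ i j, i < j → j < X.card → pos (e i) < pos (e j)) ∧
      ∀ v ∈ X, ∃ i < X.card, e i = v := by
  classical
  obtain ⟨v₀⟩ := ‹Nonempty V›
  obtain ⟨g, hg⟩ := exists_position_embedding (X := Fin X.card) (Y := X) (fun i => (i : ℕ))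
    (fun v => pos v) Fin.val_injective (fun a b e => Subtype.ext (hpos a.2 b.2 e)) (by simp)
  have hinj : Function.Injective g := by
    intro a b e
    have h1 := hg a b
    have h2 := hg b a
    rw [e] at h1 h2
    simp only [lt_self_iff_false, iff_false, not_lt] at h1 h2
    exact Fin.ext (le_antisymm h2 h1)
  have hsurj : Function.Surjective g :=
    ((Fintype.bijective_iff_injective_and_card g).2 ⟨hinj, by simp⟩).2
  refine ⟨fun i => if h : i < X.card then g ⟨i, h⟩ else v₀, fun i hi => by simp [hi],
    fun i j hij hj => ?_, fun v hv => ?_⟩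
  · simp only [hij.trans hj, hj, dif_pos]
    exact (hg _ _).1 hij
  · obtain ⟨i, hi⟩ := hsurj ⟨v, hv⟩
    exact ⟨i, i.2, by simp [hi]⟩

/-- A colour is swap invariant as soon as it is so for elements at consecutive positions. -/
theorem swapInvariant_of_consecutive {L : FirstOrder.Language.{u, v}} [L.Structure V] {S : Set V}
    {c : V → ι} {pos : V → ℕ} (hinj : Function.Injective fun v => (c v, pos v)) {k : ι}
    (h : ∀ a ∈ S, ∀ b ∈ S, c a = k → c b = k → pos a < pos b →
      (∀ e ∈ S, c e = k → ¬ (pos a < pos e ∧ pos e < pos b)) →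
      ∀ ⦃n : ℕ⦄ (r : L.Relations n) (s : Fin n → V),
        (∀ l, s l ∈ S) → (RelMap r s ↔ RelMap r ((open Classical in Equiv.swap a b) ∘ s))) :
    SwapInvariant L S c k := by
  classical
  have key : ∀ d, ∀ a ∈ S, ∀ b ∈ S, c a = k → c b = k → pos a < pos b → pos b - pos a = d →
      ∀ ⦃n : ℕ⦄ (r : L.Relations n) (s : Fin n → V), (∀ l, s l ∈ S) →
        (RelMap r s ↔ RelMap r (Equiv.swap a b ∘ s)) := by
    intro d
    induction d using Nat.strong_induction_on with
    | _ d ih =>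
      intro a ha b hb ka kb hab hd n r s hs
      by_cases hcons : ∀ e ∈ S, c e = k → ¬ (pos a < pos e ∧ pos e < pos b)
      · convert h a ha b hb ka kb hab hcons r s hs
      · push Not at hcons
        obtain ⟨e, he, ke, hae, heb⟩ := hcons
        have hS : ∀ x ∈ S, ∀ y ∈ S, ∀ z ∈ S, Equiv.swap x y z ∈ S := by
          intro x hx y hy z hz
          rw [Equiv.swap_apply_def]
          split_ifs <;> assumption
        have h1 := ih _ (by omega) a ha e he ka ke hae rfl
        have h2 := ih _ (by omega) e he b hb ke kb heb rfl
        have hab' : a ≠ b := by rintro rfl; omega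
        have heb' : e ≠ b := by rintro rfl; omega
        have hae' : a ≠ e := by rintro rfl; omega
        have hcomp : Equiv.swap a b ∘ s =
            Equiv.swap a e ∘ (Equiv.swap e b ∘ (Equiv.swap a e ∘ s)) := by
          rw [← Function.comp_assoc, ← Function.comp_assoc, ← Equiv.Perm.coe_mul,
            ← Equiv.Perm.coe_mul, Equiv.swap_comm a e, Equiv.swap_comm e b,
            Equiv.swap_mul_swap_mul_swap heb'.symm hab'.symm]
        rw [hcomp]
        exact (h1 r s hs).trans ((h2 r _ fun l => hS _ ha _ he _ (hs l)).trans
          (h1 r _ fun l => hS _ he _ hb _ (hS _ ha _ he _ (hs l))))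
  intro a ha b hb ka kb n r s hs
  rcases lt_trichotomy (pos a) (pos b) with hlt | heq | hgt
  · exact key _ a ha b hb ka kb hlt rfl r s hs
  · have : a = b := hinj (Prod.ext (ka.trans kb.symm) heq)
    subst this
    simp
  · rw [Equiv.swap_comm]
    exact key _ b hb a ha kb ka hgt rfl r s hs

/-- In a chain decomposition, each colour is either swap invariant or oriented. In the second case,
exchanging two consecutive elements affects a relation on some tuple; the entries of this tuple of
the colour at hand are moved to the two ends of the colour, where the parameters are. -/
theorem swapInvariant_or_oriented {L : FirstOrder.Language.{u, v}} [L.Structure V] [Finite V]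
    {S : Set V} {c : V → ι} {pos : V → ℕ} (hinj : Function.Injective fun v => (c v, pos v))
    (hch : ChainOn L S c pos) {m : ℕ} (hm : ∀ n, L.Relations n → n ≤ m) (k : ι) :
    SwapInvariant L S c k ∨ ∃ P : Finset V, P.card ≤ 3 * m ∧ Oriented L S c pos k P := by
  classical
  by_contra hcon
  push Not at hcon
  obtain ⟨hnsw, hP⟩ := hcon
  refine hnsw (swapInvariant_of_consecutive hinj ?_)
  intro a haS b hbS ka kb hab hcons n r s hs
  by_contra hr
  have hnm := hm n r
  let X : Finset V := (Set.toFinite {v | v ∈ S ∧ c v = k}).toFinset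
  have hX : ∀ v, v ∈ X ↔ v ∈ S ∧ c v = k := by simp [X]
  have haX : a ∈ X := (hX a).2 ⟨haS, ka⟩
  have hbX : b ∈ X := (hX b).2 ⟨hbS, kb⟩
  have hXinj : ∀ v ∈ X, ∀ w ∈ X, pos v = pos w → v = w := fun v hv w hw e =>
    hinj (Prod.ext (((hX v).1 hv).2.trans ((hX w).1 hw).2.symm) e)
  -- If there are few elements, all of them may be taken as parameters.
  by_cases hN : X.card ≤ 2 * m
  · refine hP X (by omega) ⟨n, r, ∅, ∅, fun _ => a, True, fun l => ⟨haS, haX⟩, ?_⟩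
    intro y z hy hz ky kz hyX
    exact absurd ((hX y).2 ⟨hy, ky⟩) hyX
  have : Nonempty V := ⟨a⟩
  obtain ⟨e, heX, hemono, hesurj⟩ := exists_enumeration X pos hXinj
  let R : Finset V := Finset.univ.image s
  let rkL : V → ℕ := fun v => (R.filter fun w => w ∈ X ∧ pos w < pos v).card
  let rkR : V → ℕ := fun v => (R.filter fun w => w ∈ X ∧ pos v < pos w).card
  have hRcard : R.card ≤ m := by
    refine Finset.card_image_le.trans ?_
    simpa using hnm
  have hrkL : ∀ v ∈ R, rkL v < m := by
    intro v hv
    refine lt_of_lt_of_le (Finset.card_lt_card ?_) hRcard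
    exact (Finset.filter_ssubset).2 ⟨v, hv, by simp⟩
  have hrkR : ∀ v ∈ R, rkR v < m := by
    intro v hv
    refine lt_of_lt_of_le (Finset.card_lt_card ?_) hRcard
    exact (Finset.filter_ssubset).2 ⟨v, hv, by simp⟩
  have hrkL' : ∀ v ∈ R, v ∈ X → ∀ w, pos v < pos w → rkL v < rkL w := by
    intro v hv hvX w hvw
    refine Finset.card_lt_card ⟨fun x hx => ?_, fun h => ?_⟩
    · simp only [Finset.mem_filter] at hx ⊢
      exact ⟨hx.1, hx.2.1, hx.2.2.trans hvw⟩
    · have := h (Finset.mem_filter.2 ⟨hv, hvX, hvw⟩)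
      simp at this
  have hrkR' : ∀ v, ∀ w ∈ R, w ∈ X → pos v < pos w → rkR w < rkR v := by
    intro v w hw hwX hvw
    refine Finset.card_lt_card ⟨fun x hx => ?_, fun h => ?_⟩
    · simp only [Finset.mem_filter] at hx ⊢
      exact ⟨hx.1, hx.2.1, hvw.trans hx.2.2⟩
    · have := h (Finset.mem_filter.2 ⟨hw, hwX, hvw⟩)
      simp at this
  let ix : V → ℕ := fun v => if pos v < pos a then rkL v else X.card - 1 - rkR v
  let h : V → V → V → V := fun y z v =>
    if v = a then y else if v = b then z else if v ∈ X then e (ix v) else v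
  have hix : ∀ v ∈ R, ix v < X.card := by
    intro v hv
    have := hrkL v hv
    simp only [ix]
    split_ifs <;> omega
  let P : Finset V := Finset.univ.image (fun l => h a a (s l)) ∪ (Finset.range m).image e ∪
    (Finset.range m).image fun i => e (X.card - 1 - i)
  have hsR : ∀ l, s l ∈ R := fun l => Finset.mem_image_of_mem _ (Finset.mem_univ _)
  have hPcard : P.card ≤ 3 * m := by
    have h1 : (Finset.univ.image (fun l => h a a (s l))).card ≤ m :=
      Finset.card_image_le.trans (by simpa using hnm)
    have h2 : ((Finset.range m).image e).card ≤ m := Finset.card_image_le.trans (by simp)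
    have h3 : ((Finset.range m).image fun i => e (X.card - 1 - i)).card ≤ m :=
      Finset.card_image_le.trans (by simp)
    have h4 := Finset.card_union_le (Finset.univ.image (fun l => h a a (s l)) ∪
      (Finset.range m).image e) ((Finset.range m).image fun i => e (X.card - 1 - i))
    have h5 := Finset.card_union_le (Finset.univ.image (fun l => h a a (s l)))
      ((Finset.range m).image e)
    refine h4.trans ?_
    omega
  have hmid : ∀ y ∈ X, y ∉ P → ∃ j, m ≤ j ∧ j + m < X.card ∧ e j = y := by
    intro y hy hyP
    obtain ⟨j, hj, rfl⟩ := hesurj y hy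
    refine ⟨j, ?_, ?_, rfl⟩
    · by_contra hlt
      exact hyP (Finset.mem_union_left _ (Finset.mem_union_right _
        (Finset.mem_image_of_mem _ (Finset.mem_range.2 (not_le.1 hlt)))))
    · by_contra hlt
      refine hyP (Finset.mem_union_right _ (Finset.mem_image.2
        ⟨X.card - 1 - j, Finset.mem_range.2 (by omega), ?_⟩))
      congr 1
      omega
  have hhS : ∀ y ∈ S, ∀ z ∈ S, ∀ v ∈ R, v ∈ S → h y z v ∈ S := by
    intro y hy z hz v hvR hv
    simp only [h]
    split_ifs
    · exact hy
    · exact hz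
    · exact ((hX _).1 (heX _ (hix v hvR))).1
    · exact hv
  -- Moving the tuple does not change its pattern.
  have hpat : ∀ y ∈ X, ∀ z ∈ X, y ∉ P → z ∉ P → pos y < pos z → ∀ u : Fin n → V,
      (∀ l, u l ∈ S) → (∀ l, u l ∈ R ∨ u l = a ∨ u l = b) →
      SamePattern c pos c pos u (fun l => h y z (u l)) := by
    intro y hy z hz hyP hzP hyz u huS hu
    obtain ⟨jy, hjy1, hjy2, rfl⟩ := hmid y hy hyP
    obtain ⟨jz, hjz1, hjz2, rfl⟩ := hmid z hz hzP
    have hjyz : jy < jz := by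
      by_contra hle
      rcases (not_lt.1 hle).eq_or_lt with rfl | hlt
      · omega
      · have := hemono jz jy hlt (by omega)
        omega
    have hcol : ∀ v, (v ∈ R ∨ v = a ∨ v = b) → c v = c (h (e jy) (e jz) v) := by
      intro v hv
      simp only [h]
      split_ifs with h1 h2 h3
      · rw [h1, ka, ((hX _).1 hy).2]
      · rw [h2, kb, ((hX _).1 hz).2]
      · rcases hv with hv | hv | hv
        · rw [((hX _).1 h3).2, ((hX _).1 (heX _ (hix v hv))).2]
        · exact absurd hv h1
        · exact absurd hv h2
      · rfl
    -- The index, in the enumeration, of the image of an element of the colour.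
    let jx : V → ℕ := fun v => if v = a then jy else if v = b then jz else ix v
    have hjx : ∀ v ∈ X, h (e jy) (e jz) v = e (jx v) := by
      intro v hv
      simp only [h, jx]
      split_ifs <;> rfl
    have hcases : ∀ v ∈ X, (v ∈ R ∨ v = a ∨ v = b) → (v = a ∧ jx v = jy) ∨ (v = b ∧ jx v = jz) ∨
        (v ∈ R ∧ pos v < pos a ∧ jx v = rkL v ∧ rkL v < m) ∨
        (v ∈ R ∧ pos b < pos v ∧ jx v = X.card - 1 - rkR v ∧ rkR v < m) := by
      intro v hv hvR
      by_cases h1 : v = a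
      · exact Or.inl ⟨h1, by simp [jx, h1]⟩
      by_cases h2 : v = b
      · refine Or.inr (Or.inl ⟨h2, ?_⟩)
        have : b ≠ a := by rintro rfl; exact h1 h2
        simp [jx, h2, this]
      have hvR : v ∈ R := by tauto
      have h3 := hcons v ((hX _).1 hv).1 ((hX _).1 hv).2
      have h4 : pos v ≠ pos a := fun h => h1 (hXinj _ hv _ haX h)
      have h5 : pos v ≠ pos b := fun h => h2 (hXinj _ hv _ hbX h)
      rcases lt_or_ge (pos v) (pos a) with h6 | h6
      · exact Or.inr (Or.inr (Or.inl ⟨hvR, h6, by simp [jx, ix, h1, h2, h6], hrkL v hvR⟩))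
      · refine Or.inr (Or.inr (Or.inr ⟨hvR, by omega, ?_, hrkR v hvR⟩))
        simp [jx, ix, h1, h2, not_lt.2 h6]
    have hjmono : ∀ v ∈ X, ∀ w ∈ X, (v ∈ R ∨ v = a ∨ v = b) → (w ∈ R ∨ w = a ∨ w = b) →
        pos v < pos w → jx v < jx w ∧ jx w < X.card := by
      intro v hv w hw hvR hwR hvw
      rcases hcases v hv hvR with ⟨h1, h2⟩ | ⟨h1, h2⟩ | ⟨h0, h1, h2, h3⟩ | ⟨h0, h1, h2, h3⟩ <;>
      rcases hcases w hw hwR with ⟨i1, i2⟩ | ⟨i1, i2⟩ | ⟨i0, i1, i2, i3⟩ | ⟨i0, i1, i2, i3⟩ <;>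
      rw [h2, i2] <;> (try subst h1) <;> (try subst i1) <;> try omega
      · have := hrkL' v h0 hv w hvw
        omega
      · have := hrkR' v w i0 hw hvw
        omega
    refine ⟨fun l => hcol _ (hu l), fun l l' hll => ?_⟩
    by_cases hl : c (u l) = k
    · have hlX := (hX _).2 ⟨huS l, hl⟩
      have hlX' := (hX _).2 ⟨huS l', hll ▸ hl⟩
      simp only [hjx _ hlX, hjx _ hlX']
      constructor
      · intro hlt
        have := hjmono _ hlX _ hlX' (hu l) (hu l') hlt
        exact hemono _ _ this.1 this.2
      · intro hlt
        by_contra hge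
        rcases (not_lt.1 hge).eq_or_lt with heq | hgt
        · rw [hXinj _ hlX' _ hlX heq] at hlt
          exact lt_irrefl _ hlt
        · have := hjmono _ hlX' _ hlX (hu l') (hu l) hgt
          exact lt_asymm hlt (hemono _ _ this.1 this.2)
    · have hfix : ∀ v, c v ≠ k → h (e jy) (e jz) v = v := by
        intro v hv
        have h1 : v ≠ a := by rintro rfl; exact hv ka
        have h2 : v ≠ b := by rintro rfl; exact hv kb
        have h3 : v ∉ X := fun h => hv ((hX v).1 h).2
        simp [h, h1, h2, h3]
      simp only [hfix _ hl, hfix _ (hll ▸ hl)]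
  have hne : a ≠ b := by rintro rfl; omega
  have hplug : ∀ y z, plug {l | s l = a} {l | s l = b} (fun l => h a a (s l)) y z =
      fun l => h y z (s l) := by
    intro y z
    ext l
    simp only [plug, h, Set.mem_ofPred_eq]
    split_ifs <;> rfl
  have hswS : ∀ l, (Equiv.swap a b ∘ s) l ∈ S := by
    intro l
    simp only [Function.comp_apply, Equiv.swap_apply_def]
    split_ifs
    exacts [hbS, haS, hs l]
  refine hP P hPcard ⟨n, r, {l | s l = a}, {l | s l = b}, fun l => h a a (s l), RelMap r s,
    fun l => ⟨hhS a haS a haS _ (hsR l) (hs l), ?_⟩, ?_⟩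
  · exact Finset.mem_union_left _ (Finset.mem_union_left _
      (Finset.mem_image_of_mem _ (Finset.mem_univ _)))
  intro y z hy hz ky kz hyP hzP hyz
  rw [hplug]
  have hyX := (hX y).2 ⟨hy, ky⟩
  have hzX := (hX z).2 ⟨hz, kz⟩
  have hout : ∀ l, h y z (s l) ∈ S := fun l => hhS y hy z hz _ (hsR l) (hs l)
  rcases lt_or_gt_of_ne (fun e => hyz (hXinj _ hyX _ hzX e)) with hlt | hgt
  · have := hch r s _ hs hout (hpat y hyX z hzX hyP hzP hlt s hs fun l => Or.inl (hsR l))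
    simp only [hlt, true_iff, this]
  · have h1 := hpat z hzX y hyX hzP hyP hgt (Equiv.swap a b ∘ s) hswS fun l => by
      simp only [Function.comp_apply, Equiv.swap_apply_def]
      split_ifs
      exacts [Or.inr (Or.inr rfl), Or.inr (Or.inl rfl), Or.inl (hsR l)]
    have h2 : (fun l => h z y ((Equiv.swap a b ∘ s) l)) = fun l => h y z (s l) := by
      ext l
      by_cases ha : s l = a
      · simp [h, ha, hne.symm]
      by_cases hb : s l = b
      · simp [h, hb, hne.symm]
      simp [h, ha, hb, Equiv.swap_apply_of_ne_of_ne]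
    rw [h2] at h1
    have := hch r _ _ hswS hout h1
    have h3 : ¬ pos y < pos z := by omega
    simp only [h3, false_iff, ← this]
    tauto

end Orientation

/-! ### Gluing chain decompositions of the one-point deletions -/

section Gluing

variable {L : FirstOrder.Language.{u, v}} {V ι : Type*}

/-- In a chain decomposition, the order inside a swap invariant colour is irrelevant: the entries
of `s` of such colours are replaced one after the other by those of `t`. -/
theorem rel_iff_of_swapInvariant [L.Structure V] {S : Set V} {c : V → ι} {pos : V → ℕ}
    (hch : ChainOn L S c pos) {n : ℕ} (r : L.Relations n) (t : Fin n → V) (ht : ∀ l, t l ∈ S) :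
    ∀ s : Fin n → V, (∀ l, s l ∈ S) → (∀ l, c (s l) = c (t l)) →
      (∀ l l', s l = s l' ↔ t l = t l') →
      (∀ l l', c (s l) = c (s l') → ¬ SwapInvariant L S c (c (s l)) →
        (pos (s l) < pos (s l') ↔ pos (t l) < pos (t l'))) → (RelMap r s ↔ RelMap r t) := by
  classical
  suffices H : ∀ d, ∀ s : Fin n → V, (∀ l, s l ∈ S) → (∀ l, c (s l) = c (t l)) →
      (∀ l l', s l = s l' ↔ t l = t l') →
      (∀ l l', c (s l) = c (s l') → ¬ SwapInvariant L S c (c (s l)) →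
        (pos (s l) < pos (s l') ↔ pos (t l) < pos (t l'))) →
      (Finset.univ.filter fun l => SwapInvariant L S c (c (s l)) ∧ s l ≠ t l).card = d →
      (RelMap r s ↔ RelMap r t) from fun s h1 h2 h3 h4 => H _ s h1 h2 h3 h4 rfl
  intro d
  induction d using Nat.strong_induction_on with
  | _ d ih =>
    intro s hs hcol heq hord hd
    by_cases hex : ∃ l, SwapInvariant L S c (c (s l)) ∧ s l ≠ t l
    · obtain ⟨l₀, hsw, hne⟩ := hex
      let σ := Equiv.swap (s l₀) (t l₀)
      have hσS : ∀ v ∈ S, σ v ∈ S := by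
        intro v hv
        simp only [σ, Equiv.swap_apply_def]
        split_ifs
        exacts [ht l₀, hs l₀, hv]
      have hσc : ∀ v, c (σ v) = c v := by
        intro v
        simp only [σ, Equiv.swap_apply_def]
        split_ifs with h1 h2
        · rw [h1, hcol]
        · rw [h2, hcol]
        · rfl
      have hσfix : ∀ v, ¬ SwapInvariant L S c (c v) → σ v = v := by
        intro v hv
        refine Equiv.swap_apply_of_ne_of_ne ?_ ?_
        · rintro rfl; exact hv hsw
        · rintro rfl; exact hv (hcol l₀ ▸ hsw)
      rw [hsw (s l₀) (hs l₀) (t l₀) (ht l₀) rfl (hcol l₀).symm r s hs]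
      refine ih _ ?_ (σ ∘ s) (fun l => hσS _ (hs l)) (fun l => (hσc _).trans (hcol l))
        (fun l l' => by simpa using heq l l') ?_ rfl
      · rw [← hd]
        refine Finset.card_lt_card ((Finset.ssubset_iff_of_subset ?_).2 ⟨l₀, ?_, ?_⟩)
        · intro l
          simp only [Finset.mem_filter, Finset.mem_univ, true_and, Function.comp_apply, hσc]
          rintro ⟨h1, h2⟩
          refine ⟨h1, fun h => h2 ?_⟩
          by_cases e1 : s l = s l₀
          · rw [e1, Equiv.swap_apply_left]
            exact (((heq l l₀).1 e1)).symm
          · rw [Equiv.swap_apply_of_ne_of_ne e1, h]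
            rw [h]
            exact fun e => e1 ((heq l l₀).2 e)
        · simp [hsw, hne]
        · simp [σ]
      · intro l l' h1 h2
        simp only [Function.comp_apply, hσc] at h1 h2 ⊢
        rw [hσfix _ h2, hσfix _ (h1 ▸ h2)]
        exact hord l l' h1 h2
    · push Not at hex
      refine hch r s t hs ht ⟨hcol, fun l l' h1 => ?_⟩
      by_cases hsw : SwapInvariant L S c (c (s l))
      · rw [hex l hsw, hex l' (h1 ▸ hsw)]
      · exact hord l l' h1 hsw

/-- A large finite directed graph whose out-degrees are bounded has an independent set of a given
size: some vertex has an in-degree that is not larger than the bound, and it is kept while its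
neighbours are discarded. -/
theorem exists_independent {V : Type*} [DecidableEq V] (P : V → Finset V) {q : ℕ}
    (hP : ∀ x, (P x).card ≤ q) (k : ℕ) :
    ∀ U : Finset V, (2 * q + 1) * k ≤ U.card →
      ∃ W ⊆ U, W.card = k ∧ ∀ x ∈ W, ∀ y ∈ W, x ≠ y → x ∉ P y := by
  induction k with
  | zero => exact fun U _ => ⟨∅, by simp, by simp, by simp⟩
  | succ k ih =>
    intro U hU
    have hne : U.Nonempty := by
      rw [← Finset.card_pos]
      have : 0 < (2 * q + 1) * (k + 1) := by positivity
      omega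
    obtain ⟨v, hvU, hv⟩ : ∃ v ∈ U, (U.filter fun y => v ∈ P y).card ≤ q := by
      refine Finset.exists_le_of_sum_le hne ?_
      have h1 := Finset.sum_card_bipartiteAbove_eq_sum_card_bipartiteBelow
        (s := U) (t := U) (fun v y => v ∈ P y)
      simp only [Finset.bipartiteAbove, Finset.bipartiteBelow] at h1
      rw [h1]
      refine Finset.sum_le_sum fun y _ => (Finset.card_le_card ?_).trans (hP y)
      intro v hv
      exact (Finset.mem_filter.1 hv).2
    let D : Finset V := {v} ∪ P v ∪ U.filter fun y => v ∈ P y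
    have hD : D.card ≤ 2 * q + 1 := by
      have h1 := Finset.card_union_le ({v} ∪ P v) (U.filter fun y => v ∈ P y)
      have h2 := Finset.card_union_le {v} (P v)
      have h3 := hP v
      rw [Finset.card_singleton] at h2
      refine h1.trans ?_
      omega
    obtain ⟨W, hWU, hWk, hW⟩ := ih (U \ D) (by
      have := Finset.le_card_sdiff D U
      rw [mul_add] at hU
      omega)
    have hWD : ∀ x ∈ W, x ∈ U ∧ x ≠ v ∧ x ∉ P v ∧ v ∉ P x := by
      intro x hx
      have := hWU hx
      simp only [D, Finset.mem_sdiff, Finset.mem_union, Finset.mem_singleton,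
        Finset.mem_filter] at this
      tauto
    refine ⟨insert v W, ?_, ?_, ?_⟩
    · intro x hx
      rcases Finset.mem_insert.1 hx with rfl | hx
      exacts [hvU, (hWD x hx).1]
    · rw [Finset.card_insert_of_notMem fun h => (hWD v h).2.1 rfl, hWk]
    · intro x hx y hy hxy
      rcases Finset.mem_insert.1 hx with rfl | hx' <;>
        rcases Finset.mem_insert.1 hy with rfl | hy'
      · exact absurd rfl hxy
      · exact (hWD y hy').2.2.2
      · exact (hWD x hx').2.2.1
      · exact hW x hx' y hy' hxy

/-- The colour of `v` in the common refinement of finitely many coloured and positioned sets: its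
colours, the parameters among the `p k` to which it is equal, and the parameters that precede it. -/
def refinedColour {J : Type*} {N : ℕ} (c : J → V → ι) (pos : J → V → ℕ) (p : Fin N → V) (v : V) :
    J → ι × Set (Fin N) × Set (Fin N) :=
  fun i => (c i v, {k | p k = v}, {k | pos i (p k) < pos i v})

theorem eq_of_refinedColour_eq {J : Type*} {N : ℕ} {c : J → V → ι} {pos : J → V → ℕ}
    {p : Fin N → V} {y z : V} (i : J) (h : refinedColour c pos p y = refinedColour c pos p z)
    (hy : y ∈ Set.range p) : y = z := by
  obtain ⟨k, rfl⟩ := hy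
  have := congrArg (fun x => k ∈ x.2.1) (congrFun h i)
  simpa [refinedColour] using this

/-- Positions are separated by the parameters that precede them. -/
theorem pos_lt_iff_of_ne {J : Type*} {N : ℕ} (pos : J → V → ℕ) (p : Fin N → V) (i : J) {y z : V}
    (h : {k | pos i (p k) < pos i y} ≠ {k | pos i (p k) < pos i z}) :
    pos i y < pos i z ↔ {k | pos i (p k) < pos i y} ⊆ {k | pos i (p k) < pos i z} := by
  constructor
  · intro hlt k hk
    exact lt_trans hk hlt
  · intro hsub
    by_contra hge
    refine h (hsub.antisymm fun k hk => ?_)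
    exact lt_of_lt_of_le hk (not_lt.1 hge)

/-- The refined colours determine the relative position of two elements of the same original
colour that are separated by, or equal to, a parameter. -/
theorem pos_lt_iff_of_refinedColour_eq {J : Type*} {N : ℕ} {c : J → V → ι} {pos : J → V → ℕ}
    {p : Fin N → V} {i : J} (hinj : Function.Injective fun v => (c i v, pos i v))
    {y z y' z' : V} (hy : refinedColour c pos p y = refinedColour c pos p y')
    (hz : refinedColour c pos p z = refinedColour c pos p z') (hc : c i y = c i z)
    (h : y ∈ Set.range p ∨ z ∈ Set.range p ∨
      {k | pos i (p k) < pos i y} ≠ {k | pos i (p k) < pos i z}) :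
    pos i y < pos i z ↔ pos i y' < pos i z' := by
  have hDy : {k | pos i (p k) < pos i y} = {k | pos i (p k) < pos i y'} :=
    congrArg (fun x => x.2.2) (congrFun hy i)
  have hDz : {k | pos i (p k) < pos i z} = {k | pos i (p k) < pos i z'} :=
    congrArg (fun x => x.2.2) (congrFun hz i)
  have hcy : c i y = c i y' := congrArg (fun x => x.1) (congrFun hy i)
  have hcz : c i z = c i z' := congrArg (fun x => x.1) (congrFun hz i)
  rcases h with h | h | h
  · have e := eq_of_refinedColour_eq i hy h
    subst e
    obtain ⟨k, rfl⟩ := h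
    have := congrArg (fun D => k ∈ D) hDz
    simpa using this
  · have e := eq_of_refinedColour_eq i hz h
    subst e
    by_cases hyz : y = z
    · subst hyz
      rw [eq_of_refinedColour_eq i hy h]
    have hyz' : y' ≠ z := by
      rintro rfl
      exact hyz (eq_of_refinedColour_eq i hy.symm h).symm
    have h1 : pos i y ≠ pos i z := fun e => hyz (hinj (Prod.ext hc e))
    have h2 : pos i y' ≠ pos i z := fun e => hyz' (hinj (Prod.ext (hcy.symm.trans hc) e))
    obtain ⟨k, rfl⟩ := h
    have := congrArg (fun D => k ∈ D) hDy
    simp only [Set.mem_ofPred_eq, eq_iff_iff] at this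
    omega
  · rw [pos_lt_iff_of_ne pos p i h, hDy, hDz, ← pos_lt_iff_of_ne pos p i (by rwa [← hDy, ← hDz])]

/-- Chain decompositions of the deletions of `m + 1` points, each colour of which is swap invariant
or oriented by parameters that avoid the other deleted points, have a common refinement, which is a
chain decomposition of the whole structure. Positions are taken from the first one: in an oriented
colour of another decomposition, the order of two elements is visible in the first structure, or
in a structure for which they have different colours. -/
theorem chainOn_refinedColour [L.Structure V] {m N : ℕ} (hm : ∀ n, L.Relations n → n ≤ m)
    (x : Fin (m + 1) → V) (hx : Function.Injective x) (c : Fin (m + 1) → V → ι)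
    (pos : Fin (m + 1) → V → ℕ) (hinj : ∀ i, Function.Injective fun v => (c i v, pos i v))
    (hch : ∀ i, ChainOn L {x i}ᶜ (c i) (pos i)) (p : Fin N → V) (hxp : ∀ i, x i ∈ Set.range p)
    (hor : ∀ i k, SwapInvariant L {x i}ᶜ (c i) k ∨
      ∃ P : Set V, P ⊆ Set.range p ∧ (∀ j, j ≠ i → x j ∉ P) ∧
        Oriented L {x i}ᶜ (c i) (pos i) k P) :
    ChainOn L Set.univ (refinedColour c pos p) (pos 0) := by
  have hc : ∀ {y z : V} (i), refinedColour c pos p y = refinedColour c pos p z → c i y = c i z :=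
    fun i h => congrArg (fun x => x.1) (congrFun h i)
  have hD : ∀ {y z : V} (i), refinedColour c pos p y = refinedColour c pos p z →
      {k | pos i (p k) < pos i y} = {k | pos i (p k) < pos i z} :=
    fun i h => congrArg (fun x => x.2.2) (congrFun h i)
  have hflip : ∀ (i) {y z y' z' : V}, refinedColour c pos p y = refinedColour c pos p y' →
      refinedColour c pos p z = refinedColour c pos p z' → c i y = c i z → y ≠ z → y' ≠ z' →
      (pos i y < pos i z ↔ pos i y' < pos i z') → (pos i z < pos i y ↔ pos i z' < pos i y') := by
    intro i y z y' z' hy hz hyz hne hne' h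
    have h1 : pos i y ≠ pos i z := fun e => hne (hinj i (Prod.ext hyz e))
    have h2 : pos i y' ≠ pos i z' := fun e =>
      hne' (hinj i (Prod.ext (((hc i hy).symm.trans hyz).trans (hc i hz)) e))
    omega
  have key : ∀ i, ∀ y z y' z' : V, y ≠ x i → z ≠ x i → y' ≠ x i → z' ≠ x i →
      refinedColour c pos p y = refinedColour c pos p y' →
      refinedColour c pos p z = refinedColour c pos p z' → c i y = c i z →
      ¬ SwapInvariant L {x i}ᶜ (c i) (c i y) → (y = z ↔ y' = z') →
      (refinedColour c pos p y = refinedColour c pos p z →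
        (pos 0 y < pos 0 z ↔ pos 0 y' < pos 0 z')) →
      (pos i y < pos i z ↔ pos i y' < pos i z') := by
    intro i y z y' z' hyi hzi hyi' hzi' hy hz hyz hsw heq h0
    by_cases hne : y = z
    · rw [hne, heq.1 hne]
      simp
    have hne' : y' ≠ z' := fun h => hne (heq.2 h)
    by_cases hyp : y ∈ Set.range p
    · exact pos_lt_iff_of_refinedColour_eq (hinj i) hy hz hyz (Or.inl hyp)
    by_cases hzp : z ∈ Set.range p
    · exact pos_lt_iff_of_refinedColour_eq (hinj i) hy hz hyz (Or.inr (Or.inl hzp))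
    by_cases hDi : {k | pos i (p k) < pos i y} ≠ {k | pos i (p k) < pos i z}
    · exact pos_lt_iff_of_refinedColour_eq (hinj i) hy hz hyz (Or.inr (Or.inr hDi))
    have hyp' : y' ∉ Set.range p := fun h => hyp (eq_of_refinedColour_eq i hy.symm h ▸ h)
    have hzp' : z' ∉ Set.range p := fun h => hzp (eq_of_refinedColour_eq i hz.symm h ▸ h)
    -- Some decomposition `j` arranges `y, z` and `y', z'` in the same way.
    obtain ⟨j, hj⟩ : ∃ j, c j y = c j z → (pos j y < pos j z ↔ pos j y' < pos j z') := by
      by_cases hC : refinedColour c pos p y = refinedColour c pos p z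
      · exact ⟨0, fun _ => h0 hC⟩
      · obtain ⟨j, hj⟩ := Function.ne_iff.1 hC
        refine ⟨j, fun hcj => pos_lt_iff_of_refinedColour_eq (hinj j) hy hz hcj
          (Or.inr (Or.inr fun hDj => hj ?_))⟩
        refine Prod.ext hcj (Prod.ext ?_ hDj)
        have h1 : ∀ k, p k ≠ y := fun k e => hyp ⟨k, e⟩
        have h2 : ∀ k, p k ≠ z := fun k e => hzp ⟨k, e⟩
        simp [refinedColour, h1, h2]
    by_cases hji : j = i
    · subst hji
      exact hj hyz
    obtain ⟨P, hPp, hxP, n, r, I, J, t, φ, ht, hφ⟩ := (hor i (c i y)).resolve_left hsw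
    have hnot : ∀ {a}, a ∉ Set.range p → a ∉ P := fun h h' => h (hPp h')
    have h1 := hφ y z hyi hzi rfl hyz.symm (hnot hyp) (hnot hzp) hne
    have h2 := hφ y' z' hyi' hzi' (hc i hy).symm ((hc i hz).symm.trans hyz.symm) (hnot hyp')
      (hnot hzp') hne'
    have hmem : ∀ a b, a ∉ Set.range p → b ∉ Set.range p → ∀ l,
        plug I J t a b l ∈ ({x j}ᶜ : Set V) := by
      intro a b ha hb l
      simp only [plug, Set.mem_compl_iff, Set.mem_singleton_iff]
      split_ifs
      · rintro rfl; exact ha (hxp j)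
      · rintro rfl; exact hb (hxp j)
      · intro e; exact hxP j hji (e ▸ (ht l).2)
    have hent : ∀ l, (plug I J t y z l = y ∧ plug I J t y' z' l = y') ∨
        (plug I J t y z l = z ∧ plug I J t y' z' l = z') ∨
        (plug I J t y z l ∈ Set.range p ∧ plug I J t y' z' l = plug I J t y z l) := by
      intro l
      simp only [plug]
      split_ifs
      · exact Or.inl ⟨rfl, rfl⟩
      · exact Or.inr (Or.inl ⟨rfl, rfl⟩)
      · exact Or.inr (Or.inr ⟨hPp (ht l).2, rfl⟩)
    have hentC : ∀ l, refinedColour c pos p (plug I J t y z l) =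
        refinedColour c pos p (plug I J t y' z' l) := by
      intro l
      rcases hent l with ⟨e, e'⟩ | ⟨e, e'⟩ | ⟨e, e'⟩
      · rw [e, e', hy]
      · rw [e, e', hz]
      · rw [e']
    have h3 := hch j r (plug I J t y z) (plug I J t y' z') (hmem _ _ hyp hzp) (hmem _ _ hyp' hzp')
      ⟨fun l => hc j (hentC l), fun l l' hll => by
        by_cases hl : plug I J t y z l ∈ Set.range p
        · exact pos_lt_iff_of_refinedColour_eq (hinj j) (hentC l) (hentC l') hll (Or.inl hl)
        by_cases hl' : plug I J t y z l' ∈ Set.range p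
        · exact pos_lt_iff_of_refinedColour_eq (hinj j) (hentC l) (hentC l') hll
            (Or.inr (Or.inl hl'))
        rcases hent l with ⟨e, e'⟩ | ⟨e, e'⟩ | ⟨e, e'⟩
        · rcases hent l' with ⟨f, f'⟩ | ⟨f, f'⟩ | ⟨f, f'⟩
          · rw [e, e', f, f']; simp
          · rw [e, f] at hll
            rw [e, e', f, f']
            exact hj hll
          · exact absurd f hl'
        · rcases hent l' with ⟨f, f'⟩ | ⟨f, f'⟩ | ⟨f, f'⟩
          · rw [e, f] at hll
            rw [e, e', f, f']
            exact hflip j hy hz hll.symm hne hne' (hj hll.symm)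
          · rw [e, e', f, f']; simp
          · exact absurd f hl'
        · exact absurd e hl⟩
    have h4 := h1.symm.trans (h3.trans h2)
    by_cases hφ' : φ
    · simpa only [hφ', iff_true] using h4
    · simpa only [hφ', iff_false, not_iff_not] using h4
  have hinj0 : Function.Injective fun v => (refinedColour c pos p v, pos 0 v) := by
    intro a b e
    have h2 : pos 0 a = pos 0 b := congrArg Prod.snd e
    exact hinj 0 (Prod.ext (hc 0 (congrArg Prod.fst e)) h2)
  intro n r s t _ _ hst
  -- Some deleted point is not an entry of the tuples.
  obtain ⟨i, hi⟩ : ∃ i, ∀ l, s l ≠ x i := by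
    by_contra hcon
    push Not at hcon
    choose f hf using hcon
    have hfinj : Function.Injective f := fun a b e => hx (by rw [← hf, ← hf, e])
    have := Fintype.card_le_of_injective f hfinj
    have := hm n r
    simp only [Fintype.card_fin] at *
    omega
  have hi' : ∀ l, t l ≠ x i := fun l e => hi l
    ((eq_of_refinedColour_eq i (hst.1 l).symm (e ▸ hxp i)).symm.trans e)
  have heq := hst.eq_iff hinj0 hinj0
  exact rel_iff_of_swapInvariant (hch i) r t hi' s hi (fun l => hc i (hst.1 l)) heq
    fun l l' hll hsw => key i _ _ _ _ (hi l) (hi l') (hi' l) (hi' l') (hst.1 l) (hst.1 l') hll hsw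
      (heq l l') (hst.2 l l')

theorem exists_arity_le (L : FirstOrder.Language.{u, v}) [Finite (Σ n, L.Relations n)] :
    ∃ m, ∀ n, L.Relations n → n ≤ m := by
  obtain ⟨m, hm⟩ := (Set.finite_range (Sigma.fst : (Σ n, L.Relations n) → ℕ)).bddAbove
  exact ⟨m, fun n r => hm ⟨⟨n, r⟩, rfl⟩⟩

/-- If all one-point deletions of a finite structure have chain decompositions in a fixed number of
colours, then the structure has one, in a number of colours that depends only on the given number
and on the signature. -/
theorem exists_chainDecomposable_of_deletions (L : FirstOrder.Language.{u, v})
    [Finite (Σ n, L.Relations n)] (ι : Type) [Finite ι] :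
    ∃ K : ℕ, ∀ (V : Type w) [L.Structure V] [Finite V],
      (∀ x : V, ∃ (c : V → ι) (pos : V → ℕ), Function.Injective (fun v => (c v, pos v)) ∧
        ChainOn L {x}ᶜ c pos) → ChainDecomposable L (Fin K) V := by
  classical
  obtain ⟨m, hm⟩ := exists_arity_le L
  let q := Nat.card ι * (3 * m)
  let N := (m + 1) * (q + 1)
  let κ := Fin (m + 1) → ι × Set (Fin N) × Set (Fin N)
  refine ⟨max ((2 * q + 1) * (m + 1)) (Nat.card κ), fun V _ _ h => ?_⟩
  let _ := Fintype.ofFinite V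
  by_cases hV : (2 * q + 1) * (m + 1) ≤ Fintype.card V
  · choose c pos hinj hch using h
    have hor : ∀ x k, ∃ P : Finset V, P.card ≤ 3 * m ∧
        (SwapInvariant L {x}ᶜ (c x) k ∨ Oriented L {x}ᶜ (c x) (pos x) k P) := by
      intro x k
      rcases swapInvariant_or_oriented (hinj x) (hch x) hm k with h | ⟨P, h1, h2⟩
      · exact ⟨∅, by simp, Or.inl h⟩
      · exact ⟨P, h1, Or.inr h2⟩
    choose P hP hor using hor
    let _ := Fintype.ofFinite ι
    have hPq : ∀ x, (Finset.univ.biUnion (P x)).card ≤ q := by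
      intro x
      refine (Finset.card_biUnion_le_card_mul _ _ _ fun k _ => hP x k).trans ?_
      simp [q]
    obtain ⟨W, -, hW, hind⟩ := exists_independent (fun x => Finset.univ.biUnion (P x)) hPq (m + 1)
      Finset.univ (by simpa using hV)
    let e : Fin (m + 1) ≃ W := (W.equivFinOfCardEq hW).symm
    let x : Fin (m + 1) → V := fun i => e i
    have hx : Function.Injective x := fun i j h => e.injective (Subtype.ext h)
    let A : Finset V := Finset.univ.biUnion fun i => insert (x i) (Finset.univ.biUnion (P (x i)))
    have hA : A.card ≤ N := by
      refine (Finset.card_biUnion_le_card_mul _ _ (q + 1) fun i _ => ?_).trans ?_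
      · exact (Finset.card_insert_le _ _).trans (Nat.succ_le_succ (hPq _))
      · simp [N]
    obtain ⟨p, hp⟩ : ∃ p : Fin N → V, (A : Set V) ⊆ Set.range p := by
      refine ⟨fun k => if h : (k : ℕ) < A.card then A.equivFin.symm ⟨k, h⟩ else x 0, ?_⟩
      intro a ha
      let k := A.equivFin ⟨a, ha⟩
      refine ⟨⟨k, k.2.trans_le hA⟩, ?_⟩
      simp [k]
    have hxA : ∀ i, x i ∈ A := fun i =>
      Finset.mem_biUnion.2 ⟨i, Finset.mem_univ _, Finset.mem_insert_self _ _⟩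
    have hPA : ∀ i k, P (x i) k ⊆ A := fun i k a ha => Finset.mem_biUnion.2
      ⟨i, Finset.mem_univ _, Finset.mem_insert_of_mem
        (Finset.mem_biUnion.2 ⟨k, Finset.mem_univ _, ha⟩)⟩
    have hdec : ChainDecomposable L κ V := by
      refine ⟨refinedColour (fun i => c (x i)) (fun i => pos (x i)) p, pos (x 0), fun a b h => ?_,
        chainOn_refinedColour hm x hx _ _ (fun i => hinj (x i)) (fun i => hch (x i)) p
          (fun i => hp (hxA i)) fun i k => (hor (x i) k).imp_right fun h =>
            ⟨P (x i) k, fun a ha => hp (hPA i k ha), fun j hj hmem => ?_, h⟩⟩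
      · have h1 := congrArg (fun y => (y.1 0).1) h
        have h2 : pos (x 0) a = pos (x 0) b := congrArg Prod.snd h
        exact hinj (x 0) (Prod.ext h1 h2)
      · exact hind _ (e j).2 _ (e i).2 (fun h => hj (hx h))
          (Finset.mem_biUnion.2 ⟨k, Finset.mem_univ _, hmem⟩)
    exact hdec.fin_card.mono_fin (le_max_right _ _)
  · have hdec : ChainDecomposable L V V := by
      refine ⟨id, fun _ => 0, fun a b h => congrArg Prod.fst h, fun n r s t _ _ h => ?_⟩
      rw [show s = t from funext h.1]
    refine hdec.fin_card.mono_fin (le_max_of_le_left ?_)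
    rw [Nat.card_eq_fintype_card]
    omega

end Gluing

/-! ### Ramsey's theorem -/

/-- Ramsey's theorem, for all subsets with at most `n` elements at once. The limit colour
of a set is that of its extensions by one large element, along a nonprincipal ultrafilter. The terms
of the sequence are chosen one by one so that extending a set of earlier terms by the new one
yields the limit colour, for each of the iterated limits. -/
theorem exists_strictMono_ramsey {κ : Type*} [Finite κ] (χ : Finset ℕ → κ) (n : ℕ) :
    ∃ h : ℕ → ℕ, StrictMono h ∧ ∀ A B : Finset ℕ, A.card = B.card → A.card ≤ n →
      χ (A.image h) = χ (B.image h) := by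
  classical
  have hlim : ∀ F : ℕ → κ, ∃ k, ∀ᶠ x in (Filter.hyperfilter ℕ : Filter ℕ), F x = k := by
    intro F
    obtain ⟨k, -, hk⟩ := (Ultrafilter.eventually_exists_mem_iff (f := Filter.hyperfilter ℕ)
      (is := (Set.univ : Set κ)) (P := fun k x => F x = k) Set.finite_univ).1 (by simp)
    exact ⟨k, hk⟩
  choose lim hlim using hlim
  -- `F i` is the `i`-th iterated limit of the colouring.
  let F : ℕ → Finset ℕ → κ := fun i => Nat.rec χ (fun _ G A => lim fun x => G (insert x A)) i
  have hF : ∀ i A, ∀ᶠ x in (Filter.hyperfilter ℕ : Filter ℕ), F i (insert x A) = F (i + 1) A :=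
    fun i A => hlim fun x => F i (insert x A)
  have hpick : ∀ s : Finset ℕ, ∃ x, (∀ y ∈ s, y < x) ∧
      ∀ t ∈ s.powerset, ∀ i ∈ Finset.range n, F i (insert x t) = F (i + 1) t := by
    intro s
    have h1 : ∀ᶠ x in (Filter.hyperfilter ℕ : Filter ℕ), ∀ y ∈ s, y < x := by
      rw [Filter.eventually_all_finset]
      intro y _
      refine Filter.Eventually.filter_mono Nat.hyperfilter_le_atTop ?_
      exact Filter.eventually_gt_atTop y
    have h2 : ∀ᶠ x in (Filter.hyperfilter ℕ : Filter ℕ), ∀ t ∈ s.powerset,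
        ∀ i ∈ Finset.range n, F i (insert x t) = F (i + 1) t := by
      rw [Filter.eventually_all_finset]
      intro t _
      rw [Filter.eventually_all_finset]
      exact fun i _ => hF i t
    exact (h1.and h2).exists
  choose pick hpick1 hpick2 using hpick
  let S : ℕ → Finset ℕ := fun k => Nat.rec ∅ (fun _ s => insert (pick s) s) k
  let h : ℕ → ℕ := fun k => pick (S k)
  have hS : ∀ k, S (k + 1) = insert (h k) (S k) := fun k => rfl
  have hmem : ∀ j k, j < k → h j ∈ S k := by
    intro j k hjk
    induction k with
    | zero => omega
    | succ k ih =>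
      rw [hS]
      rcases Nat.lt_succ_iff_lt_or_eq.1 hjk with h1 | rfl
      · exact Finset.mem_insert_of_mem (ih h1)
      · exact Finset.mem_insert_self _ _
  have hmono : StrictMono h := fun j k hjk => hpick1 _ _ (hmem j k hjk)
  have key : ∀ A : Finset ℕ, ∀ i, i + A.card ≤ n → F i (A.image h) = F (i + A.card) ∅ := by
    intro A
    induction A using Finset.induction_on_max with
    | empty => simp
    | insert a s hs ih =>
      intro i hi
      have ha : a ∉ s := fun h => lt_irrefl _ (hs a h)
      rw [Finset.card_insert_of_notMem ha] at hi ⊢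
      rw [Finset.image_insert, hpick2 (S a) _ _ i (Finset.mem_range.2 (by omega)),
        ih (i + 1) (by omega), add_assoc, add_comm 1]
      refine Finset.mem_powerset.2 fun x hx => ?_
      obtain ⟨j, hj, rfl⟩ := Finset.mem_image.1 hx
      exact hmem _ _ (hs j hj)
  refine ⟨h, hmono, fun A B hAB hA => ?_⟩
  have h1 := key A 0 (by omega)
  have h2 := key B 0 (by omega)
  rw [hAB] at h1
  exact h1.trans h2.symm

/-- The number of distinct values satisfying a condition on indices depends only on the order type
of a tuple. -/
theorem card_image_filter_eq {n : ℕ} {j j' : Fin n → ℕ}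
    (h : ∀ l l', j l < j l' ↔ j' l < j' l') (T : Finset (Fin n)) :
    (T.image j).card = (T.image j').card := by
  have aux : ∀ j j' : Fin n → ℕ, (∀ l l', j l < j l' ↔ j' l < j' l') →
      (T.image j').card ≤ (T.image j).card := by
    intro j j' h
    have hg : ∀ l l', j l = j l' → j' l = j' l' := by
      intro l l' e
      have h1 := h l l'
      have h2 := h l' l
      omega
    obtain ⟨g, hg⟩ : ∃ g : ℕ → ℕ, ∀ l, j' l = g (j l) := by
      refine ⟨Function.extend j j' 0, fun l => ?_⟩
      exact (Function.FactorsThrough.extend_apply (fun a b e => hg a b e) 0 l).symm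
    have : T.image j' = (T.image j).image g := by
      rw [Finset.image_image]
      exact Finset.image_congr fun l _ => hg l
    rw [this]
    exact Finset.card_image_le
  exact le_antisymm (aux j' j fun l l' => (h l l').symm) (aux j j' h)

/-- Finitely many sequences in a structure can be thinned out simultaneously so that the relations
on a tuple of their terms depend only on the sequences used and on the order of the indices. -/
theorem exists_indiscernible {L : FirstOrder.Language.{u, v}} [Finite (Σ n, L.Relations n)]
    {V : Type*} [L.Structure V] {ι : Type*} [Finite ι] (b : ι → ℕ → V) :
    ∃ h : ℕ → ℕ, StrictMono h ∧ ∀ ⦃n : ℕ⦄ (r : L.Relations n) (κ : Fin n → ι) (j j' : Fin n → ℕ),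
      (∀ l l', j l < j l' ↔ j' l < j' l') →
      (RelMap r (fun l => b (κ l) (h (j l))) ↔ RelMap r (fun l => b (κ l) (h (j' l)))) := by
  classical
  obtain ⟨m, hm⟩ := exists_arity_le L
  -- The colour of a set records the relations between the terms with indices in this set.
  let χ : Finset ℕ → ∀ p : (Σ n, L.Relations n), (Fin p.1 → ι) → (Fin p.1 → Fin p.1) → Prop :=
    fun A p κ ρ => RelMap p.2 fun l => b (κ l) (Nat.nth (· ∈ A) (ρ l))
  obtain ⟨h, hmono, hh⟩ := exists_strictMono_ramsey χ m
  refine ⟨h, hmono, fun n r κ j j' hjj' => ?_⟩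
  have hle := hm n r
  have hrank : ∀ (j : Fin n → ℕ) (l : Fin n),
      ((Finset.univ.filter fun l' => j l' < j l).image j).card < n := by
    intro j l
    refine lt_of_le_of_lt Finset.card_image_le ?_
    conv_rhs => rw [← Finset.card_fin n]
    exact Finset.card_lt_card (Finset.filter_ssubset.2 ⟨l, Finset.mem_univ _, by simp⟩)
  have key : ∀ j : Fin n → ℕ, RelMap r (fun l => b (κ l) (h (j l))) ↔
      χ ((Finset.univ.image j).image h) ⟨n, r⟩ κ fun l =>
        ⟨((Finset.univ.filter fun l' => j l' < j l).image j).card, hrank j l⟩ := by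
    intro j
    have : ∀ l, h (j l) = Nat.nth (· ∈ (Finset.univ.image j).image h)
        ((Finset.univ.filter fun l' => j l' < j l).image j).card := by
      intro l
      have hc : Nat.count (· ∈ (Finset.univ.image j).image h) (h (j l)) =
          ((Finset.univ.filter fun l' => j l' < j l).image j).card := by
        rw [Nat.count_eq_card_filter_range, ← Finset.card_image_of_injective
          ((Finset.univ.filter fun l' => j l' < j l).image j) hmono.injective]
        congr 1
        ext x
        simp only [Finset.mem_filter, Finset.mem_range, Finset.mem_image, Finset.mem_univ, true_and,
          exists_exists_eq_and]
        constructor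
        · rintro ⟨h1, l', rfl⟩
          exact ⟨_, ⟨l', hmono.lt_iff_lt.1 h1, rfl⟩, rfl⟩
        · rintro ⟨_, ⟨l', h1, rfl⟩, rfl⟩
          exact ⟨hmono h1, l', rfl⟩
      rw [← hc, Nat.nth_count]
      exact Finset.mem_image_of_mem _ (Finset.mem_image_of_mem _ (Finset.mem_univ _))
    simp only [χ, ← this]
  rw [key, key, hh (Finset.univ.image j) (Finset.univ.image j')
    (card_image_filter_eq hjj' _)
    (Finset.card_image_le.trans (by simpa using hle))]
  have : (fun l : Fin n => (⟨((Finset.univ.filter fun l' => j l' < j l).image j).card, hrank j l⟩ :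
      Fin n)) = fun l => ⟨((Finset.univ.filter fun l' => j' l' < j' l).image j').card,
        hrank j' l⟩ := by
    ext l
    have : (Finset.univ.filter fun l' => j l' < j l) = Finset.univ.filter fun l' => j' l' < j' l :=
      Finset.filter_congr fun l' _ => hjj' l' l
    simp only [this]
    exact card_image_filter_eq hjj' _
  rw [this]

/-! ### Finite monomorphic decompositions and chain decompositions -/

section Ages

variable {L : FirstOrder.Language.{u, v}} [L.IsRelational]

theorem mem_age_iff {V : Type w} [L.Structure V] {N : Bundled.{w} L.Structure} :
    N ∈ L.age V ↔ Finite N ∧ Nonempty (N ↪[L] V) :=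
  and_congr Structure.fg_iff_finite Iff.rfl

theorem nonempty_equiv_of_embeddings {V W : Type*} [L.Structure V] [L.Structure W] [Finite V]
    [Finite W] (f : V ↪[L] W) (g : W ↪[L] V) : Nonempty (V ≃[L] W) := by
  have hbij : Function.Bijective f :=
    f.injective.bijective_of_nat_card_le (Nat.card_le_card_of_injective g g.injective)
  exact ⟨{ toEquiv := Equiv.ofBijective f hbij
           map_fun' := fun φ => isEmptyElim φ
           map_rel' := fun r x => f.map_rel r x }⟩

/-- The colours of a finite monomorphic decomposition can be refined so that each of them is
infinite or used once, and then carries a sequence that is either injective or constant. -/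
theorem HasFiniteMonomorphicDecomposition.exists_colouring {V : Type w} [L.Structure V]
    (h : HasFiniteMonomorphicDecomposition L V) :
    ∃ (ι : Type w) (_ : Finite ι) (c : V → ι) (b : ι → ℕ → V), (∀ k j, c (b k j) = k) ∧
      (∀ k, Function.Injective (b k) ∨ ∀ x y, c x = k → c y = k → x = y) ∧
      ∀ (A A' : Finset V) (g : V → V), Set.InjOn g A → g '' A = A' → (∀ x ∈ A, c (g x) = c x) →
        Nonempty (restriction L (A : Set V) ≃[L] restriction L (A' : Set V)) := by
  classical
  obtain ⟨P, hPfin, hP, hmono⟩ := h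
  have := hPfin.to_subtype
  choose B hB hBuniq using hP.2
  simp only [and_imp] at hBuniq
  let c : V → P ⊕ V := fun x => if (B x).Infinite then Sum.inl ⟨B x, (hB x).1⟩ else Sum.inr x
  have hcB : ∀ x y, c x = c y → B x = B y := by
    intro x y h
    simp only [c] at h
    split_ifs at h
    · simpa using h
    · rw [Sum.inr.inj h]
  have hfin : (Set.range c).Finite := by
    have h1 : {x | ¬ (B x).Infinite}.Finite := by
      refine ((hPfin.subset (Set.sep_subset P Set.Finite)).sUnion fun b hb => hb.2).subset ?_
      intro x hx
      exact ⟨B x, ⟨(hB x).1, Set.not_infinite.1 hx⟩, (hB x).2⟩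
    refine ((Set.finite_range (Sum.inl : P → P ⊕ V)).union (h1.image Sum.inr)).subset ?_
    rintro _ ⟨x, rfl⟩
    by_cases hx : (B x).Infinite
    · exact Or.inl ⟨⟨B x, (hB x).1⟩, by simp [c, hx]⟩
    · exact Or.inr ⟨x, hx, by simp [c, hx]⟩
  have hseq : ∀ k : Set.range c, ∃ b : ℕ → V, (∀ j, c (b j) = k) ∧
      (Function.Injective b ∨ ∀ x y, c x = k → c y = k → x = y) := by
    rintro ⟨_, x, rfl⟩
    by_cases hx : (B x).Infinite
    · let e := hx.natEmbedding
      refine ⟨fun j => e j, fun j => ?_, Or.inl fun i j h => e.injective (Subtype.ext h)⟩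
      have : B (e j) = B x := (hBuniq _ _ (hB x).1 (e j).2).symm
      simp [c, this, hx]
    · refine ⟨fun _ => x, fun _ => rfl, Or.inr ?_⟩
      have aux : ∀ y, c y = c x → y = x := by
        intro y hy
        have h1 := hcB y x hy
        simpa [c, h1, hx] using hy
      intro y z hy hz
      rw [aux y hy, aux z hz]
  choose b hb1 hb2 using hseq
  refine ⟨Set.range c, hfin.to_subtype, fun x => ⟨c x, x, rfl⟩, b, fun k j => Subtype.ext (hb1 k j),
    fun k => (hb2 k).imp_right fun h x y hx hy => h x y (congrArg Subtype.val hx)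
      (congrArg Subtype.val hy), fun A A' g hg hgA hgc => hmono A A' fun D hD => ?_⟩
  have : (A' : Set V) ∩ D = g '' (A ∩ D) := by
    have hmem : ∀ x, x ∈ D ↔ B x = D := fun x =>
      ⟨fun h => (hBuniq x D hD h).symm, fun h => h ▸ (hB x).2⟩
    have hBg : ∀ x ∈ A, B (g x) = B x := fun x hx => hcB _ _ (congrArg Subtype.val (hgc x hx))
    ext y
    rw [← hgA]
    constructor
    · rintro ⟨⟨x, hx, rfl⟩, hy⟩
      exact ⟨x, ⟨hx, (hmem x).2 ((hBg x hx).symm.trans ((hmem _).1 hy))⟩, rfl⟩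
    · rintro ⟨x, ⟨hx, hxD⟩, rfl⟩
      exact ⟨⟨x, hx, rfl⟩, (hmem _).2 ((hBg x hx).trans ((hmem x).1 hxD))⟩
  rw [this, (hg.mono Set.inter_subset_left).ncard_image]

/-- The finite structures that embed in a structure with a finite monomorphic decomposition have
chain decompositions in a bounded number of colours: a finite restriction is isomorphic to one with
the same number of elements of each colour inside an indiscernible family of sequences. -/
theorem HasFiniteMonomorphicDecomposition.exists_chainDecomposable
    [Finite (Σ n, L.Relations n)] {V : Type w} [L.Structure V]
    (h : HasFiniteMonomorphicDecomposition L V) :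
    ∃ K : ℕ, ∀ N ∈ L.age V, ChainDecomposable L (Fin K) N := by
  classical
  obtain ⟨ι, _, c, b, hb1, hb2, hmono⟩ := h.exists_colouring
  obtain ⟨h, hh, hind⟩ := exists_indiscernible (L := L) b
  refine ⟨Nat.card ι, fun N hN => ?_⟩
  obtain ⟨_, ⟨f⟩⟩ := mem_age_iff.1 hN
  refine ChainDecomposable.fin_card ?_
  let A : Finset V := (Set.finite_range f).toFinset
  have hfA : ∀ x, f x ∈ A := fun x => by simp [A]
  obtain ⟨ν, hν, hνA⟩ : ∃ ν : V → ℕ, Set.InjOn ν A ∧ ∀ x ∈ A, ν x < A.card := by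
    refine ⟨fun x => if hx : x ∈ A then A.equivFin ⟨x, hx⟩ else 0, fun x hx y hy h => ?_,
      fun x hx => by simp [hx]⟩
    have hx' : x ∈ A := hx
    have hy' : y ∈ A := hy
    simp only [hx', hy', dif_pos] at h
    simpa using A.equivFin.injective (Fin.ext h)
  -- Indices of distinct colours are taken from distinct intervals of length `A.card`.
  let ix : V → ℕ := fun x => Finite.equivFin ι (c x) * A.card + ν x
  have hix : ∀ x ∈ A, ∀ y ∈ A, c x ≠ c y →
      (ix x < ix y ↔ (Finite.equivFin ι (c x) : ℕ) < Finite.equivFin ι (c y)) := by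
    intro x hx y hy hxy
    have h1 := hνA x hx
    have h2 := hνA y hy
    have h3 : (Finite.equivFin ι (c x) : ℕ) ≠ Finite.equivFin ι (c y) := fun e =>
      hxy ((Finite.equivFin ι).injective (Fin.ext e))
    simp only [ix]
    generalize (Finite.equivFin ι (c x) : ℕ) = p at *
    generalize (Finite.equivFin ι (c y) : ℕ) = q at *
    rcases lt_or_gt_of_ne h3 with h4 | h4
    · have := Nat.mul_le_mul_right A.card (Nat.succ_le_of_lt h4)
      rw [Nat.succ_mul] at this
      simp only [h4, iff_true]
      omega
    · have := Nat.mul_le_mul_right A.card (Nat.succ_le_of_lt h4)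
      rw [Nat.succ_mul] at this
      simp only [not_lt.2 h4.le, iff_false]
      omega
  have hixinj : ∀ x ∈ A, ∀ y ∈ A, c x = c y → ix x = ix y → x = y := by
    intro x hx y hy hc he
    simp only [ix, hc, add_right_inj] at he
    exact hν hx hy he
  let g : V → V := fun x => b (c x) (h (ix x))
  have hgc : ∀ x, c (g x) = c x := fun x => hb1 _ _
  have hginj : Set.InjOn g A := by
    intro x hx y hy e
    have hc : c x = c y := by rw [← hgc, e, hgc]
    rcases hb2 (c x) with h1 | h1
    · refine hixinj x hx y hy hc (hh.injective (h1 ?_))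
      change b (c x) _ = b (c y) _ at e
      rw [← hc] at e
      exact e
    · exact h1 x y rfl hc.symm
  obtain ⟨φ⟩ := hmono A (A.image g) g hginj (by simp) fun x _ => hgc x
  let f' : N ↪[L] restriction L (A : Set V) := f.codRestrict (restriction L (A : Set V)) hfA
  let ψ : N ↪[L] V := (Substructure.subtype _).comp (φ.toEmbedding.comp f')
  have hψ : ∀ x, ∃ a ∈ A, g a = ψ x := by
    intro x
    have : ψ x ∈ A.image g := (φ (f' x)).2
    exact Finset.mem_image.1 this
  choose a haA ha using hψ
  refine ⟨fun x => c (a x), fun x => ν (a x), fun x y e => ?_, fun n r s t _ _ hst => ?_⟩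
  · have h1 : c (a x) = c (a y) := congrArg Prod.fst e
    have h2 : ν (a x) = ν (a y) := congrArg Prod.snd e
    have h3 := hν (haA x) (haA y) h2
    exact ψ.injective (by rw [← ha, ← ha, h3])
  · have hrel : ∀ s : Fin n → N,
        RelMap r s ↔ RelMap r fun l => b (c (a (s l))) (h (ix (a (s l)))) := by
      intro s
      rw [← ψ.map_rel]
      have : ψ ∘ s = fun l => b (c (a (s l))) (h (ix (a (s l)))) :=
        funext fun l => (ha (s l)).symm
      rw [this]
    rw [hrel s, hrel t, hind r _ _ (fun l => ix (a (t l)))]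
    · simp only [hst.1]
    · intro l l'
      by_cases hc : c (a (s l)) = c (a (s l'))
      · have hc' : c (a (t l)) = c (a (t l')) := (hst.1 l).symm.trans (hc.trans (hst.1 l'))
        have := hst.2 l l' hc
        simp only [ix, hc, hc', add_lt_add_iff_left]
        exact this
      · have hc' : c (a (t l)) ≠ c (a (t l')) := fun e =>
          hc ((hst.1 l).trans (e.trans (hst.1 l').symm))
        have h1 : c (a (s l)) = c (a (t l)) := hst.1 l
        have h2 : c (a (s l')) = c (a (t l')) := hst.1 l'
        rw [hix _ (haA _) _ (haA _) hc, hix _ (haA _) _ (haA _) hc', h1, h2]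

/-- By compactness, a structure has a finite monomorphic decomposition as soon as its finite
restrictions have chain decompositions in a bounded number of colours. -/
theorem hasFiniteMonomorphicDecomposition_of_age {V : Type w} [L.Structure V] {K : ℕ}
    (h : ∀ N ∈ L.age V, ChainDecomposable L (Fin K) N) :
    HasFiniteMonomorphicDecomposition L V := by
  classical
  have hS : ∀ S : Finset V, ChainDecomposable L (Fin K) (restriction L (S : Set V)) := fun S =>
    h (Bundled.of (restriction L (S : Set V)))
      (mem_age_iff.2 ⟨S.finite_toSet.to_subtype, ⟨Substructure.subtype _⟩⟩)
  choose cS pS hinj hch using hS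
  -- Every element receives the colour that it has in most finite restrictions.
  let U : Ultrafilter (Finset V) := Ultrafilter.of Filter.atTop
  have hU : ∀ v : V, ∃ k, ∀ᶠ S in (U : Filter (Finset V)), ∃ hv : v ∈ S, cS S ⟨v, hv⟩ = k := by
    intro v
    refine Ultrafilter.eventually_exists_iff.1 ?_
    have : ∀ᶠ S : Finset V in Filter.atTop, v ∈ S := by
      filter_upwards [Filter.eventually_ge_atTop {v}] with S hS
      exact hS (Finset.mem_singleton_self v)
    filter_upwards [Ultrafilter.of_le _ this] with S hS
    exact ⟨_, hS, rfl⟩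
  choose c hc using hU
  have key : ∀ A A' : Finset V, (∀ k, Nat.card {v : A // c v = k} ≤ Nat.card {v : A' // c v = k}) →
      Nonempty (restriction L (A : Set V) ↪[L] restriction L (A' : Set V)) := by
    intro A A' hcard
    have : ∀ᶠ S in (U : Filter (Finset V)), ∀ v ∈ A ∪ A', ∃ hv : v ∈ S, cS S ⟨v, hv⟩ = c v := by
      rw [Filter.eventually_all_finset]
      exact fun v _ => hc v
    obtain ⟨S, hS⟩ := this.exists
    have hA : ∀ v : restriction L (A : Set V), (v : V) ∈ A ∪ A' := fun v =>
      Finset.mem_union_left _ v.2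
    have hA' : ∀ v : restriction L (A' : Set V), (v : V) ∈ A ∪ A' := fun v =>
      Finset.mem_union_right _ v.2
    let i : restriction L (A : Set V) → restriction L (S : Set V) := fun v => ⟨v, (hS v (hA v)).1⟩
    let i' : restriction L (A' : Set V) → restriction L (S : Set V) := fun v =>
      ⟨v, (hS v (hA' v)).1⟩
    have hi : ∀ v, cS S (i v) = c v := fun v => (hS v (hA v)).2
    have hi' : ∀ v, cS S (i' v) = c v := fun v => (hS v (hA' v)).2
    have : Finite (restriction L (A : Set V)) := A.finite_toSet.to_subtype
    have : Finite (restriction L (A' : Set V)) := A'.finite_toSet.to_subtype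
    refine nonempty_embedding_of_samePattern
      (c := fun v : restriction L (A : Set V) => c v)
      (c' := fun v : restriction L (A' : Set V) => c v)
      (pos := fun v => pS S (i v)) (pos' := fun v => pS S (i' v)) ?_ ?_ ?_ hcard
    · intro x y e
      have := hinj S (a₁ := i x) (a₂ := i y) (by simpa only [hi] using e)
      exact Subtype.ext (congrArg (fun z : restriction L (S : Set V) => (z : V)) this)
    · intro x y e
      have := hinj S (a₁ := i' x) (a₂ := i' y) (by simpa only [hi'] using e)
      exact Subtype.ext (congrArg (fun z : restriction L (S : Set V) => (z : V)) this)
    · intro n r s t hst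
      refine hch S r (i ∘ s) (i' ∘ t) (by simp) (by simp) ⟨fun l => ?_, fun l l' e => ?_⟩
      · simpa only [Function.comp_apply, hi, hi'] using hst.1 l
      · refine hst.2 l l' ?_
        simpa only [Function.comp_apply, hi] using e
  refine ⟨(Setoid.ker c).classes, Setoid.finite_classes_ker c, Setoid.isPartition_classes _,
    fun A A' hcount => ?_⟩
  have hcard : ∀ k, Nat.card {v : A // c v = k} = Nat.card {v : A' // c v = k} := by
    intro k
    have aux : ∀ A : Finset V,
        Nat.card {v : A // c v = k} = ((A : Set V) ∩ {v | c v = k}).ncard := by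
      intro A
      refine Nat.card_congr ⟨fun v => ⟨v.1, v.1.2, v.2⟩, fun v => ⟨⟨v.1, v.2.1⟩, v.2.2⟩,
        fun _ => rfl, fun _ => rfl⟩
    rw [aux, aux]
    by_cases hk : ∃ y, c y = k
    · obtain ⟨y, rfl⟩ := hk
      exact hcount _ ⟨y, rfl⟩
    · have : {v | c v = k} = ∅ := Set.eq_empty_of_forall_notMem fun v hv => hk ⟨v, hv⟩
      rw [this, Set.inter_empty, Set.inter_empty]
  have : Finite (restriction L (A : Set V)) := A.finite_toSet.to_subtype
  have : Finite (restriction L (A' : Set V)) := A'.finite_toSet.to_subtype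
  obtain ⟨f⟩ := key A A' fun k => (hcard k).le
  obtain ⟨g⟩ := key A' A fun k => (hcard k).ge
  exact nonempty_equiv_of_embeddings f g

end Ages

/-! ### Well-quasi-ordered hereditary classes -/

section Classes

variable {L : FirstOrder.Language.{u, v}}

/-- The embeddability quasi-order. -/
def Embeds (M N : Bundled.{w} L.Structure) : Prop :=
  Nonempty (M ↪[L] N)

theorem Embeds.trans {M N P : Bundled.{w} L.Structure} (h : Embeds M N) (h' : Embeds N P) :
    Embeds M P :=
  ⟨h'.some.comp h.some⟩

/-- A class that contains every structure embedding in one of its members. -/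
def DownClosed (C : Set (Bundled.{w} L.Structure)) : Prop :=
  ∀ M ∈ C, ∀ N, Embeds N M → N ∈ C

/-- There is no infinite strictly decreasing sequence of hereditary classes, the differences of
which meet a given well-quasi-ordered class. -/
theorem not_descending {S : Set (Bundled.{w} L.Structure)}
    (hS : S.PartiallyWellOrderedOn Embeds) (H : ℕ → Set (Bundled.{w} L.Structure))
    (hH : ∀ n, DownClosed (H n)) (hanti : ∀ n, H (n + 1) ⊆ H n)
    (x : ℕ → Bundled.{w} L.Structure) (hxS : ∀ n, x n ∈ S) (hx : ∀ n, x n ∈ H n)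
    (hx' : ∀ n, x n ∉ H (n + 1)) : False := by
  obtain ⟨m, n, hmn, h⟩ := hS.exists_lt hxS
  exact hx' m (hH _ _ (antitone_nat_of_succ_le hanti (Nat.succ_le_of_lt hmn) (hx n)) _ h)

variable [L.IsRelational]

theorem downClosed_age (V : Type w) [L.Structure V] : DownClosed (L.age V) := by
  rintro M hM N ⟨f⟩
  obtain ⟨_, ⟨g⟩⟩ := mem_age_iff.1 hM
  exact mem_age_iff.2 ⟨Finite.of_injective f f.injective, ⟨g.comp f⟩⟩

/-- A finite signature has countably many finite structures up to isomorphism. -/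
theorem countable_quotient_of_finite [Finite (Σ n, L.Relations n)]
    {C : Set (Bundled.{w} L.Structure)} (hC : ∀ M ∈ C, Finite M) :
    (Quotient.mk' '' C : Set (Quotient (equivSetoid (L := L)))).Countable := by
  have hfin : ∀ n : ℕ, Finite (L.Structure (ULift.{w} (Fin n))) := by
    intro n
    let F : L.Structure (ULift.{w} (Fin n)) →
        ∀ p : (Σ n, L.Relations n), (Fin p.1 → ULift.{w} (Fin n)) → Prop :=
      fun s p x => s.RelMap p.2 x
    refine Finite.of_injective F fun s t h => Structure.ext ?_ ?_
    · funext k f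
      exact isEmptyElim f
    · funext k r x
      exact congrFun (congrFun h ⟨k, r⟩) x
  let q : (Σ n : ℕ, L.Structure (ULift.{w} (Fin n))) → Quotient (equivSetoid (L := L)) :=
    fun p => Quotient.mk' ⟨ULift.{w} (Fin p.1), p.2⟩
  refine (Set.countable_range q).mono ?_
  rintro _ ⟨M, hM, rfl⟩
  have := hC M hM
  let e : M ≃ ULift.{w} (Fin (Nat.card M)) := (Finite.equivFin M).trans Equiv.ulift.symm
  refine ⟨⟨Nat.card M, e.inducedStructure⟩, Quotient.sound ?_⟩
  let _ := e.inducedStructure (L := L)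
  exact ⟨(e.inducedStructureEquiv (L := L)).symm⟩

/-- A nonempty hereditary class of finite structures in which any two members embed in a third is
an age. -/
theorem exists_eq_age [Finite (Σ n, L.Relations n)] {C : Set (Bundled.{w} L.Structure)}
    (hfin : ∀ M ∈ C, Finite M) (hC : DownClosed C) (hne : C.Nonempty)
    (hjoint : ∀ M ∈ C, ∀ N ∈ C, ∃ P ∈ C, Embeds M P ∧ Embeds N P) :
    ∃ R : Bundled.{w} L.Structure, C = L.age R := by
  obtain ⟨R, -, hR⟩ := exists_cg_is_age_of hne (countable_quotient_of_finite hfin)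
    (fun M hM => Structure.fg_iff_finite.2 (hfin M hM)) (fun M hM N hN => hC M hM N hN.2)
    (fun M hM N hN => hjoint M hM N hN)
  exact ⟨R, hR.symm⟩

/-- A well-quasi-ordered hereditary class of finite structures is a finite union of ages: otherwise
there is a class that is minimal among those which are not, and it is not directed, hence
the union of two smaller hereditary classes. -/
theorem exists_finite_union_ages [Finite (Σ n, L.Relations n)] {C : Set (Bundled.{w} L.Structure)}
    (hfin : ∀ M ∈ C, Finite M) (hC : DownClosed C) (hpwo : C.PartiallyWellOrderedOn Embeds) :
    ∃ S : Set (Bundled.{w} L.Structure), S.Finite ∧ C = ⋃ R ∈ S, L.age R := by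
  let U : Set (Bundled.{w} L.Structure) → Prop := fun H =>
    ∃ S : Set (Bundled.{w} L.Structure), S.Finite ∧ H = ⋃ R ∈ S, L.age R
  change U C
  by_contra hbad
  have step : ∀ H : {H // DownClosed H ∧ H ⊆ C ∧ ¬ U H},
      ∃ (H' : {H // DownClosed H ∧ H ⊆ C ∧ ¬ U H}) (x : Bundled.{w} L.Structure),
        H'.1 ⊆ H.1 ∧ x ∈ H.1 ∧ x ∉ H'.1 := by
    rintro ⟨H, hH, hHC, hU⟩
    have hne : H.Nonempty := by
      rw [Set.nonempty_iff_ne_empty]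
      rintro rfl
      exact hU ⟨∅, Set.finite_empty, by simp⟩
    have hnj : ¬ ∀ M ∈ H, ∀ N ∈ H, ∃ P ∈ H, Embeds M P ∧ Embeds N P := by
      intro hj
      obtain ⟨R, hR⟩ := exists_eq_age (fun M hM => hfin M (hHC hM)) hH hne hj
      exact hU ⟨{R}, Set.finite_singleton R, by simpa using hR⟩
    push Not at hnj
    obtain ⟨a, ha, b, hb, hab⟩ := hnj
    have hdown : ∀ a, DownClosed {M | M ∈ H ∧ ¬ Embeds a M} := fun a M hM N hN =>
      ⟨hH M hM.1 N hN, fun h => hM.2 (h.trans hN)⟩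
    have hsub : ∀ a, {M | M ∈ H ∧ ¬ Embeds a M} ⊆ C := fun a M hM => hHC hM.1
    have hself : ∀ a, a ∉ {M | M ∈ H ∧ ¬ Embeds a M} := fun a h => h.2 ⟨Embedding.refl L a⟩
    by_cases h1 : U {M | M ∈ H ∧ ¬ Embeds a M}
    · by_cases h2 : U {M | M ∈ H ∧ ¬ Embeds b M}
      · exfalso
        obtain ⟨S, hS, hS'⟩ := h1
        obtain ⟨T, hT, hT'⟩ := h2
        refine hU ⟨S ∪ T, hS.union hT, ?_⟩
        rw [Set.biUnion_union, ← hS', ← hT']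
        ext M
        simp only [Set.mem_union, Set.mem_ofPred_eq]
        constructor
        · intro hM
          by_cases haM : Embeds a M
          · exact Or.inr ⟨hM, hab M hM haM⟩
          · exact Or.inl ⟨hM, haM⟩
        · rintro (h | h) <;> exact h.1
      · exact ⟨⟨_, hdown b, hsub b, h2⟩, b, fun M hM => hM.1, hb, hself b⟩
    · exact ⟨⟨_, hdown a, hsub a, h1⟩, a, fun M hM => hM.1, ha, hself a⟩
  choose next x hnext hx hx' using step
  let H : ℕ → {H // DownClosed H ∧ H ⊆ C ∧ ¬ U H} := fun n =>
    Nat.rec ⟨C, hC, subset_rfl, hbad⟩ (fun _ H => next H) n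
  exact not_descending hpwo (fun n => (H n).1) (fun n => (H n).2.1) (fun n => hnext (H n))
    (fun n => x (H n)) (fun n => (H n).2.2.1 (hx _)) (fun n => hx _) (fun n => hx' _)

/-! ### Hereditary classes that contain no age without finite monomorphic decomposition -/

variable [Finite (Σ n, L.Relations n)]

theorem partiallyWellOrderedOn_chainDecomposable (K : ℕ) :
    {M : Bundled.{w} L.Structure | Finite M ∧ ChainDecomposable L (Fin K) M}.PartiallyWellOrderedOn
      Embeds := by
  rw [Set.partiallyWellOrderedOn_iff_exists_lt]
  intro f hf
  exact exists_embedding_of_chainDecomposable f (fun n => (hf n).1) fun n => (hf n).2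

theorem IsFiniteUnionOfFMDAges.exists_chainDecomposable {C : Set (Bundled.{w} L.Structure)}
    (h : IsFiniteUnionOfFMDAges C) : ∃ K : ℕ, ∀ M ∈ C, ChainDecomposable L (Fin K) M := by
  obtain ⟨S, hS, hfmd, rfl⟩ := h
  have : ∀ R : S, ∃ K : ℕ, ∀ N ∈ L.age R.1, ChainDecomposable L (Fin K) N := fun R =>
    (hfmd R R.2).exists_chainDecomposable
  choose K hK using this
  have := hS.to_subtype
  obtain ⟨B, hB⟩ := (Set.finite_range K).bddAbove
  refine ⟨B, fun M hM => ?_⟩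
  simp only [Set.mem_iUnion] at hM
  obtain ⟨R, hR, hM⟩ := hM
  exact (hK ⟨R, hR⟩ M hM).mono_fin (hB ⟨⟨R, hR⟩, rfl⟩)

/-- If the members of a class have chain decompositions in a bounded number of colours, then so do
the finite structures whose proper restrictions all belong to the class. -/
theorem exists_chainDecomposable_of_bounds {J : Set (Bundled.{w} L.Structure)} {K : ℕ}
    (hJ : ∀ M ∈ J, ChainDecomposable L (Fin K) M) :
    ∃ K' : ℕ, ∀ M : Bundled.{w} L.Structure, Finite M →
      (∀ N, Embeds N M → Nat.card N < Nat.card M → N ∈ J) → ChainDecomposable L (Fin K') M := by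
  classical
  obtain ⟨K', hK'⟩ := exists_chainDecomposable_of_deletions.{u, v, w} L (Option (Fin K))
  refine ⟨K', fun M _ hM => hK' M fun x => ?_⟩
  have hmem : (⟨restriction L ({x}ᶜ : Set M), inferInstance⟩ : Bundled.{w} L.Structure) ∈ J := by
    refine hM _ ⟨Substructure.subtype _⟩ ?_
    exact Finite.card_subtype_lt (p := fun y : M => y ∈ ({x}ᶜ : Set M)) (x := x) (by simp)
  obtain ⟨c, pos, hinj, hch⟩ := hJ _ hmem
  -- The deleted point receives a colour of its own.
  let c' : M → Option (Fin K) := fun y => if h : y ∈ ({x}ᶜ : Set M) then some (c ⟨y, h⟩) else none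
  let pos' : M → ℕ := fun y => if h : y ∈ ({x}ᶜ : Set M) then pos ⟨y, h⟩ else 0
  have hc' : ∀ y (h : y ∈ ({x}ᶜ : Set M)), c' y = some (c ⟨y, h⟩) := fun y h => dif_pos h
  have hpos' : ∀ y (h : y ∈ ({x}ᶜ : Set M)), pos' y = pos ⟨y, h⟩ := fun y h => dif_pos h
  have hcx : ∀ y, y ∉ ({x}ᶜ : Set M) → c' y = none := fun y h => dif_neg h
  refine ⟨c', pos', fun y z e => ?_, fun n r s t hs ht hst => ?_⟩
  · have e1 : c' y = c' z := congrArg Prod.fst e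
    have e2 : pos' y = pos' z := congrArg Prod.snd e
    by_cases hy : y ∈ ({x}ᶜ : Set M) <;> by_cases hz : z ∈ ({x}ᶜ : Set M)
    · rw [hc' y hy, hc' z hz, Option.some_inj] at e1
      rw [hpos' y hy, hpos' z hz] at e2
      exact congrArg Subtype.val (hinj (a₁ := ⟨y, hy⟩) (a₂ := ⟨z, hz⟩) (Prod.ext e1 e2))
    · rw [hc' y hy, hcx z hz] at e1
      cases e1
    · rw [hcx y hy, hc' z hz] at e1
      cases e1
    · simp only [Set.mem_compl_iff, Set.mem_singleton_iff, not_not] at hy hz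
      rw [hy, hz]
  · refine hch r (fun l => ⟨s l, hs l⟩) (fun l => ⟨t l, ht l⟩) (by simp) (by simp)
      ⟨fun l => ?_, fun l l' e => ?_⟩
    · have := hst.1 l
      rwa [hc' _ (hs l), hc' _ (ht l), Option.some_inj] at this
    · have := hst.2 l l' (by rw [hc' _ (hs l), hc' _ (hs l'), e])
      rwa [hpos' _ (hs l), hpos' _ (hs l'), hpos' _ (ht l), hpos' _ (ht l')] at this

theorem isFiniteUnionOfFMDAges_of_partiallyWellOrderedOn {C : Set (Bundled.{w} L.Structure)}
    (hfin : ∀ M ∈ C, Finite M) (hC : DownClosed C) (hpwo : C.PartiallyWellOrderedOn Embeds)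
    (hno : ∀ R : Bundled.{w} L.Structure, L.age R ⊆ C → HasFiniteMonomorphicDecomposition L R) :
    IsFiniteUnionOfFMDAges C := by
  obtain ⟨S, hS, rfl⟩ := exists_finite_union_ages hfin hC hpwo
  exact ⟨S, hS, fun R hR => hno R
    (Set.subset_biUnion_of_mem (u := fun R : Bundled.{w} L.Structure => L.age R) hR), rfl⟩

/-- A hereditary class of finite structures, all the ages in which have finite monomorphic
decompositions, is well-quasi-ordered, hence a finite union of such ages. Otherwise, the structures
that lie strictly below a minimal bad sequence form a well-quasi-ordered class; it is a finite union
of ages, so that the terms of the sequence have chain decompositions in a bounded number of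
colours. -/
theorem isFiniteUnionOfFMDAges_of_forall_age {C : Set (Bundled.{w} L.Structure)}
    (hfin : ∀ M ∈ C, Finite M) (hC : DownClosed C)
    (hno : ∀ R : Bundled.{w} L.Structure, L.age R ⊆ C → HasFiniteMonomorphicDecomposition L R) :
    IsFiniteUnionOfFMDAges C := by
  refine isFiniteUnionOfFMDAges_of_partiallyWellOrderedOn hfin hC ?_ hno
  rw [Set.PartiallyWellOrderedOn.iff_not_exists_isMinBadSeq
    fun M : Bundled.{w} L.Structure => Nat.card M]
  rintro ⟨f, hf, hmin⟩
  let J : Set (Bundled.{w} L.Structure) :=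
    {N | ∃ n, Embeds N (f n) ∧ Nat.card N < Nat.card (f n)}
  have hJC : J ⊆ C := by
    rintro N ⟨n, h, -⟩
    exact hC _ (hf.1 n) N h
  have hJdown : DownClosed J := by
    rintro M ⟨n, h, hlt⟩ N hN
    have := hfin M (hJC ⟨n, h, hlt⟩)
    exact ⟨n, hN.trans h, (Nat.card_le_card_of_injective _ hN.some.injective).trans_lt hlt⟩
  have hJpwo : J.PartiallyWellOrderedOn Embeds := by
    rw [Set.PartiallyWellOrderedOn.iff_forall_not_isBadSeq]
    rintro g ⟨hgJ, hg⟩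
    choose ν hν hlt using hgJ
    -- The bad sequence `g` is continued to the left by the terms of `f`.
    let k := Function.argmin ν
    refine hmin (ν k) (fun i => if i < ν k then f i else g (k + (i - ν k)))
      (fun i hi => by simp [hi]) (by simpa using hlt k) ⟨fun i => ?_, fun i j hij => ?_⟩
    · dsimp only
      split_ifs
      · exact hf.1 i
      · exact hJC ⟨_, hν _, hlt _⟩
    · dsimp only
      by_cases hj : j < ν k
      · rw [if_pos hj, if_pos (hij.trans hj)]
        exact hf.2 i j hij
      · rw [if_neg hj]
        by_cases hi : i < ν k
        · rw [if_pos hi]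
          intro h
          exact hf.2 i _ (hi.trans_le (Function.argmin_le ν _)) (h.trans (hν _))
        · rw [if_neg hi]
          exact hg _ _ (by omega)
  obtain ⟨K, hK⟩ := (isFiniteUnionOfFMDAges_of_partiallyWellOrderedOn
    (fun M hM => hfin M (hJC hM)) hJdown hJpwo
    fun R hR => hno R (hR.trans hJC)).exists_chainDecomposable
  obtain ⟨K', hK'⟩ := exists_chainDecomposable_of_bounds hK
  obtain ⟨m, n, hmn, h⟩ := (partiallyWellOrderedOn_chainDecomposable (L := L) K').exists_lt
    (f := f) fun n => ⟨hfin _ (hf.1 n), hK' _ (hfin _ (hf.1 n)) fun N hN hlt => ⟨n, hN, hlt⟩⟩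
  exact hf.2 m n hmn h

theorem not_isNonFMDAge_of_subset {C D : Set (Bundled.{w} L.Structure)}
    (hC : IsFiniteUnionOfFMDAges C) (hDC : D ⊆ C) : ¬ IsNonFMDAge D := by
  rintro ⟨R, hR, rfl⟩
  obtain ⟨K, hK⟩ := hC.exists_chainDecomposable
  exact hR (hasFiniteMonomorphicDecomposition_of_age fun N hN => hK N (hDC hN))

/-- A chain of ages of structures without finite monomorphic decomposition is bounded from below.
If its intersection contained no such age, the minimal structures outside this intersection would
have chain decompositions in a bounded number of colours, and those found while descending along the
chain would form a bad sequence. -/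
theorem exists_isNonFMDAge_lowerBound {c : Set (Set (Bundled.{w} L.Structure))}
    (hc : ∀ D ∈ c, IsNonFMDAge D) (hchain : IsChain (· ⊆ ·) c) (hne : c.Nonempty) :
    ∃ D, IsNonFMDAge D ∧ ∀ D' ∈ c, D ⊆ D' := by
  by_contra hcon
  push Not at hcon
  have hdown : ∀ D ∈ c, DownClosed D := by
    intro D hD
    obtain ⟨R, -, rfl⟩ := hc D hD
    exact downClosed_age R
  have hfin : ∀ D ∈ c, ∀ M ∈ D, Finite M := by
    intro D hD M hM
    obtain ⟨R, -, rfl⟩ := hc D hD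
    exact (mem_age_iff.1 hM).1
  obtain ⟨D₀, hD₀⟩ := hne
  have hU : IsFiniteUnionOfFMDAges (⋂₀ c) := by
    refine isFiniteUnionOfFMDAges_of_forall_age (fun M hM => hfin D₀ hD₀ M (hM D₀ hD₀))
      (fun M hM N hN D hD => hdown D hD M (hM D hD) N hN) fun R hR => ?_
    by_contra hnot
    obtain ⟨D, hD, hRD⟩ := hcon (L.age R) ⟨R, hnot, rfl⟩
    exact hRD (hR.trans (Set.sInter_subset_of_mem hD))
  obtain ⟨K, hK⟩ := hU.exists_chainDecomposable
  obtain ⟨K', hK'⟩ := exists_chainDecomposable_of_bounds hK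
  have step : ∀ D : c, ∃ (D' : c) (M : Bundled.{w} L.Structure), D'.1 ⊆ D.1 ∧
      (Finite M ∧ ChainDecomposable L (Fin K') M) ∧ M ∈ D.1 ∧ M ∉ D'.1 := by
    rintro ⟨D, hD⟩
    have hex : ∃ M, M ∈ D ∧ M ∉ ⋂₀ c := by
      by_contra hsub
      push Not at hsub
      exact not_isNonFMDAge_of_subset hU hsub (hc D hD)
    let E : Set (Bundled.{w} L.Structure) := {M | M ∈ D ∧ M ∉ ⋂₀ c}
    let M := Function.argminOn (fun M : Bundled.{w} L.Structure => Nat.card M) E hex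
    obtain ⟨hMD, hMc⟩ : M ∈ E := Function.argminOn_mem _ E hex
    have hMmin : ∀ N ∈ E, Nat.card M ≤ Nat.card N := fun N hN => Function.argminOn_le
      (fun M : Bundled.{w} L.Structure => Nat.card M) E hN
    have := hfin D hD M hMD
    have hM : ChainDecomposable L (Fin K') M := by
      refine hK' M this fun N hN hlt => ?_
      by_contra hNc
      exact absurd (hMmin N ⟨hdown D hD M hMD N hN, hNc⟩) (not_le.2 hlt)
    simp only [Set.mem_sInter, not_forall] at hMc
    obtain ⟨D', hD', hMD'⟩ := hMc
    refine ⟨⟨D', hD'⟩, M, ?_, ⟨this, hM⟩, hMD, hMD'⟩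
    exact (hchain.total hD' hD).resolve_right fun h => hMD' (h hMD)
  choose next x hnext hxK hx hx' using step
  let H : ℕ → c := fun n => Nat.rec ⟨D₀, hD₀⟩ (fun _ D => next D) n
  exact not_descending (partiallyWellOrderedOn_chainDecomposable (L := L) K') (fun n => (H n).1)
    (fun n => hdown _ (H n).2) (fun n => hnext (H n)) (fun n => x (H n)) (fun n => hxK _)
    (fun n => hx _) (fun n => hx' _)

end Classes

end Monomorphic

theorem mainTheorem2 (L : FirstOrder.Language.{u, v}) [L.IsRelational]
    [Finite (Σ n, L.Relations n)]
    (C : Set (CategoryTheory.Bundled.{w} L.Structure))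
    (hfin : ∀ M ∈ C, Finite M)
    (hher : FirstOrder.Language.Hereditary C) :
    Xor (Monomorphic.IsFiniteUnionOfFMDAges C)
      (∃ D : Set (CategoryTheory.Bundled.{w} L.Structure),
        D ⊆ C ∧ Minimal Monomorphic.IsNonFMDAge D) := by
  by_cases hU : Monomorphic.IsFiniteUnionOfFMDAges C
  · refine Or.inl ⟨hU, ?_⟩
    rintro ⟨D, hDC, hD⟩
    exact Monomorphic.not_isNonFMDAge_of_subset hU hDC hD.prop
  · refine Or.inr ⟨?_, hU⟩
    have hdown : Monomorphic.DownClosed C := by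
      rintro M hM N ⟨f⟩
      have := hfin M hM
      exact hher M hM (Monomorphic.mem_age_iff.2 ⟨Finite.of_injective f f.injective, ⟨f⟩⟩)
    obtain ⟨R, hRC, hR⟩ : ∃ R : CategoryTheory.Bundled.{w} L.Structure, L.age R ⊆ C ∧
        ¬ Monomorphic.HasFiniteMonomorphicDecomposition L R := by
      by_contra hcon
      push Not at hcon
      exact hU (Monomorphic.isFiniteUnionOfFMDAges_of_forall_age hfin hdown hcon)
    obtain ⟨D, hDR, hD⟩ := zorn_superset_nonempty {D | Monomorphic.IsNonFMDAge D}
      (fun c hc hchain hne => Monomorphic.exists_isNonFMDAge_lowerBound hc hchain hne)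
      (L.age R) ⟨R, hR, rfl⟩
    exact ⟨D, hDR.trans hRC, hD⟩
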